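/- Let $k\ge 1$, $T\ge 2$, and let $\mathcal K\subset\mathbb R^k$ (Euclidean norm) be closed and convex with $r\mathbb B^k\subseteq\mathcal K\subseteq R\,\mathbb B^k$, $0<r<R$. An oblivious adversary fixes * timestamps $0<l_1<\dots<l_T$ and $r_t>l_t$ ($t\in[T]$), all $2T$ of them distinct: prediction $x_t$ is requested at time $l_t$, and its feedback arrives at time $r_t$. Put $d_t=|\{s: l_t<l_s<r_t\}|$ (so that the feedback of round $t$ arrives in round $t+d_t$), $\sigma_t=|\{s: l_s<l_t<r_s\}|$, $d^\star_t=|\{s: l_t<r_s<r_t\}|$, $\sigma^\star_t=|\{s: l_s<r_t<r_s\}|$, $d_{\mathrm{tot}}=\sum_t d_t$, $\sigma_{\max}=\max_t\sigma_t$; * differentiable convex losses $f_t:\mathcal K\to\mathbb R$ with $\|\nabla f_t\|\le G$ and $|f_t|\le M$ on $\mathcal K$, each $\lambda$-strongly convex ($\lambda>0$): $f_t(y)\ge f_t(x)+\langle\nabla f_t(x),y-x\rangle+\frac\lambda2\|y-x\|^2$ for all $x,y\in\mathcal K$. Let $\nu=\frac{M}{Gr}$ and $\varphi(t)=r\min\{1,(\nu^2k^2\ln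 t/t)^{1/3}\}$. The algorithm $\mathcal W_{\mathrm{BCO}}(\mathcal B)$ maintains the current output $\bar z$ of a base algorithm $\mathcal B$. In round $t=1,\dots,T$ it draws $u_t$ uniformly from the unit sphere $\mathbb S^{k-1}$, independently of the past, and predicts $x_t=(1-\frac{\delta_t}{r})\bar z+\delta_tu_t$; then, for each $s$ with $s+d_s=t$, in increasing order of $r_s$, it receives $f_s(x_s)$, sends $(\frac k{\delta_s}f_s(x_s)u_s,\,d^\star_s,\,\sigma^\star_s)$ to $\mathcal B$, and replaces $\bar z$ by the new output of $\mathcal B$. Let $\mathcal B$ be P-FTRL: starting from any $z_1\in\mathcal K$, after the loss vectors $c_1,\dots,c_n$ it outputs $$z_{n+1}=\operatorname*{arg\,min}_{z\in\mathcal K}\ \sum_{m=1}^n\Big(\langle c_m,z\rangle+\tfrac{\alpha_m}{2}\|z_m-z\|^2\Big),\qquad \alpha_1=\tfrac1{\eta_1},\quad \alpha_m=\tfrac1{\eta_m}-\tfrac1{\eta_{m-1}}\ (m\ge2),$$ with $\eta_n=\frac1{n\lambda}$. Let the smoothing parameters be either fixed, $\delta_t=\varphi(T)$ for all $t$, or round-dependent,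 $\delta_t=\varphi(t)$ for $t\ge3$ with $\delta_1,\delta_2$ any values in $[\varphi(2),\varphi(3)]$. Then there is an absolute constant $C>0$, independent of all the above data, such that for $x^*\in\arg\min_{x\in\mathcal K}\sum_{t=1}^Tf_t(x)$ the regret $\sum_{t=1}^T(f_t(x_t)-f_t(x^*))$ is integrable and $$\mathbb E\Big[\sum_{t=1}^T\big(f_t(x_t)-f_t(x^*)\big)\Big]\le C\,\frac{G^2}{\lambda}\Big[\min\{\sigma_{\max}\ln T,\ \sqrt{d_{\mathrm{tot}}}\}+T^{2/3}(\ln T)^{1/3}(\nu k)^{2/3}\Big].$$ -/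

import Mathlib

open MeasureTheory ProbabilityTheory

noncomputable section

namespace DelayedBCO

/-- The ambient space `ℝ^k` with the Euclidean norm. -/
abbrev Vec (k : ℕ) := EuclideanSpace ℝ (Fin k)

/-- The unit sphere `𝕊^{k-1}` of `ℝ^k`. -/
abbrev UnitSphere (k : ℕ) := Metric.sphere (0 : Vec k) 1

/-- The uniform probability distribution on `𝕊^{k-1}`: normalized surface measure. -/
def unifSphere (k : ℕ) : Measure (UnitSphere k) :=
  ((volume : Measure (Vec k)).toSphere Set.univ)⁻¹ • (volume : Measure (Vec k)).toSphere

/-! ### Continuous time model for delays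

Rounds are indexed by `Fin T`; the index `t : Fin T` stands for round number `t + 1`. -/

/-- Latency intervals `(l t, r t)`: the prediction of round `t` is requested at time `l t` and its
feedback is revealed at time `r t`; all timestamps are distinct. -/
structure LatencyModel (T : ℕ) where
  l : Fin T → ℝ
  r : Fin T → ℝ
  l_pos : ∀ t, 0 < l t
  l_strictMono : StrictMono l
  l_lt_r : ∀ t, l t < r t
  r_injective : Function.Injective r
  l_ne_r : ∀ s t, l s ≠ r t

namespace LatencyModel

variable {T : ℕ} (τ : LatencyModel T)

/-- Delay `d_t`: number of predictions made during the `t`-th latency interval. -/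
def delay (t : Fin T) : ℕ :=
  (Finset.univ.filter fun s => τ.l t < τ.l s ∧ τ.l s < τ.r t).card

/-- Backlog `σ_t`: number of earlier predictions still awaiting feedback at time `l t`. -/
def backlog (t : Fin T) : ℕ :=
  (Finset.univ.filter fun s => τ.l s < τ.l t ∧ τ.l t < τ.r s).card

/-- Dual delay `d*_t`: number of observations made during the `t`-th latency interval. -/
def dualDelay (t : Fin T) : ℕ :=
  (Finset.univ.filter fun s => τ.l t < τ.r s ∧ τ.r s < τ.r t).card

/-- Dual backlog `σ*_t`: number of predictions still awaiting feedback at time `r t`. -/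
def dualBacklog (t : Fin T) : ℕ :=
  (Finset.univ.filter fun s => τ.l s < τ.r t ∧ τ.r t < τ.r s).card

/-- The total delay `d_tot`. -/
def totalDelay : ℕ := ∑ t, τ.delay t

/-- The maximal backlog `σ_max`. -/
def maxBacklog : ℕ := Finset.univ.sup τ.backlog

/-- The rounds listed in observation order, i.e. by increasing feedback time `r`. -/
def obsOrder : List (Fin T) :=
  (List.finRange T).mergeSort fun s t => decide (τ.r s ≤ τ.r t)

/-- The rounds `s` with `s + d_s = t`, whose feedback arrives at the end of round `t`, in
observation order. -/
def arrivals (t : Fin T) : List (Fin T) :=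
  τ.obsOrder.filter fun s => decide ((s : ℕ) + τ.delay s = (t : ℕ))

end LatencyModel

/-! ### Base algorithms and P-FTRL -/

/-- A message `(c, d*, σ*)` sent to a base algorithm: loss vector, lag, number of outstanding
lags. -/
abbrev Message (k : ℕ) := Vec k × ℕ × ℕ

/-- A (deterministic) base algorithm: the list of messages received so far, in chronological order,
is mapped to the current base prediction. -/
abbrev BaseAlgorithm (k : ℕ) := List (Message k) → Vec k

/-- A minimizer of `Φ` over `K`. -/
def argminOn {k : ℕ} (K : Set (Vec k)) (Φ : Vec k → ℝ) : Vec k :=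
  Classical.epsilon fun z => z ∈ K ∧ IsMinOn Φ K z

/-- `α_1 = 1/η_1` and `α_n = 1/η_n - 1/η_{n-1}` for `n ≥ 2`. -/
def proxWeight (η : ℕ → ℝ) (n : ℕ) : ℝ :=
  if n ≤ 1 then 1 / η n else 1 / η n - 1 / η (n - 1)

/-- State of P-FTRL after `n` updates: the number `n`, the current prediction `z_{n+1}` and the
accumulated objective `z ↦ ∑_{m ≤ n} (⟨c_m, z⟩ + α_m/2 ‖z_m - z‖²)`. -/
structure FTRLState (k : ℕ) where
  n : ℕ
  z : Vec k
  obj : Vec k → ℝ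

/-- The state before the first update, with prediction `z_1`. -/
def FTRLState.init {k : ℕ} (z₁ : Vec k) : FTRLState k := ⟨0, z₁, fun _ => 0⟩

/-- One P-FTRL update with the loss vector `c = c_{n+1}`. -/
def FTRLState.update {k : ℕ} (K : Set (Vec k)) (η : ℕ → ℝ) (S : FTRLState k) (c : Vec k) :
    FTRLState k :=
  let obj' : Vec k → ℝ := fun z =>
    S.obj z + (inner ℝ c z + proxWeight η (S.n + 1) / 2 * ‖S.z - z‖ ^ 2)
  ⟨S.n + 1, argminOn K obj', obj'⟩

/-- P-FTRL on `K` with learning rates `η` and initial point `z₁`: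
`z_{n+1} = argmin_{z ∈ K} ∑_{m ≤ n} (⟨c_m, z⟩ + α_m/2 ‖z_m - z‖²)`. -/
def pFTRL {k : ℕ} (K : Set (Vec k)) (η : ℕ → ℝ) (z₁ : Vec k) : BaseAlgorithm k := fun msgs =>
  (msgs.foldl (fun S m => S.update K η m.1) (FTRLState.init z₁)).z

/-! ### The bandit wrapper -/

/-- State of the wrapper: messages sent so far to the base algorithm, and predictions made so far
(entries of future rounds are `0` and not used). -/
structure WrapperState (k T : ℕ) where
  msgs : List (Message k)
  pred : Fin T → Vec k

section Wrapper

variable {k T : ℕ} (B : BaseAlgorithm k) (r : ℝ) (δ : ℕ → ℝ) (τ : LatencyModel T)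
  (f : Fin T → Vec k → ℝ) (u : Fin T → UnitSphere k)

/-- One round of the wrapper, with base algorithm `B`, smoothing parameters `δ` (indexed by the
round number `1, 2, …`), losses `f` and exploration directions `u`: predict
`x_t = (1 - δ_t/r) z̄ + δ_t u_t`, where `z̄` is the current output of `B`; then, for each `s` with
`s + d_s = t` in observation order, receive `f_s(x_s)` and send `((k/δ_s) f_s(x_s) u_s, d*_s, σ*_s)`
to `B`. -/
def wrapperRound (t : Fin T) (S : WrapperState k T) : WrapperState k T :=
  let x : Vec k := (1 - δ ((t : ℕ) + 1) / r) • B S.msgs + δ ((t : ℕ) + 1) • (u t : Vec k)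
  let pred' : Fin T → Vec k := Function.update S.pred t x
  { msgs := S.msgs ++ (τ.arrivals t).map fun s : Fin T =>
      (((k : ℝ) / δ ((s : ℕ) + 1) * f s (pred' s)) • (u s : Vec k), τ.dualDelay s, τ.dualBacklog s)
    pred := pred' }

/-- The state of the wrapper after the first `n` rounds. -/
def wrapperState : ℕ → WrapperState k T
  | 0 => ⟨[], fun _ => 0⟩
  | n + 1 => if h : n < T then wrapperRound B r δ τ f u ⟨n, h⟩ (wrapperState n) else wrapperState n

/-- The prediction `x_t` of the wrapper in round `t`. -/
def prediction (t : Fin T) : Vec k := (wrapperState B r δ τ f u T).pred t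

/-- The regret `R_T(v) = ∑_t (f_t(x_t) - f_t(v))` of the wrapper against the comparator `v`. -/
def regret (v : Vec k) : ℝ := ∑ t, (f t (prediction B r δ τ f u t) - f t v)

end Wrapper

/-! ### Losses and smoothing schedules -/

/-- `f` is `lam`-strongly convex on `K`, in first-order form. -/
def IsStronglyConvex {k : ℕ} (lam : ℝ) (K : Set (Vec k)) (f : Vec k → ℝ) : Prop :=
  ∀ x ∈ K, ∀ y ∈ K,
    f x + inner ℝ (gradientWithin f K x) (y - x) + lam / 2 * ‖y - x‖ ^ 2 ≤ f y

/-- `φ(t) = r min {1, (ν² k² ln t / t)^{1/3}}`. -/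
def smoothing (k : ℕ) (r ν : ℝ) (t : ℕ) : ℝ :=
  r * min 1 ((ν ^ 2 * (k : ℝ) ^ 2 * Real.log t / t) ^ (1 / 3 : ℝ))

/-- The round-dependent schedule `δ_t = φ(t)`. As `φ(1) = 0` is not an admissible smoothing
parameter and `φ` is only non-increasing from `t = 3` on (`φ(2) = φ(4) ≤ φ(3)`), the formula is
imposed for `t ≥ 3`, and `δ_1, δ_2` may be any values between `φ(2)` and `φ(3)`; this includes
`δ_2 = φ(2)` as well as the non-increasing choice `δ_1 = δ_2 = φ(3)`. -/
def IsRoundDependentSchedule (k : ℕ) (r ν : ℝ) (δ : ℕ → ℝ) : Prop :=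
  (∀ t, 3 ≤ t → δ t = smoothing k r ν t) ∧
    ∀ t, 1 ≤ t → t ≤ 2 → smoothing k r ν 2 ≤ δ t ∧ δ t ≤ smoothing k r ν 3

/-- The fixed schedule `δ_t = φ(T)` for all rounds `t`. -/
def IsFixedSchedule (k T : ℕ) (r ν : ℝ) (δ : ℕ → ℝ) : Prop :=
  ∀ t, 1 ≤ t → δ t = smoothing k r ν T

end DelayedBCO

end

/-! Listed by increasing feedback time, the loss vectors reach P-FTRL one by one, and in that order
P-FTRL suffers no delay. Round `s` is played from the iterate with index `seen s`, while its loss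
vector is processed at the iterate with index `rank s`; the gap between the two indices is exactly
the dual delay (`seen_add_dualDelay`). The regret therefore splits into an undelayed P-FTRL regret,
the drift between these two iterates, and the bias caused by smoothing.

Undelayed regret. The rates `1/(nλ)` make every proximal weight equal to `λ`, so the proximal terms
match the curvature of the losses, and the surrogate regret is at most the sum of `‖c_j‖²/(2(j+1)λ)`
(`ftrl_regret_le`). With `V` bounding the loss vectors, this is of order `V² ln T/λ`.

Bias. The mean of the one-point estimator behaves like an average of subgradients over a ball of
radius `δ` (`inner_onePoint_le`). This follows from pairing each direction with its mirror image and
from the second moments of the sphere. Its norm is thus at most `G`, although the estimator itself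
may be as large as `V`. Strong convexity and the gradient bound force the diameter of `K` to be at
most `2G/λ`, so the bias per round is of order `(δ/r) G²/λ`, and `R` never enters the bound.

Drift. Crude bounds would charge each delayed loss vector its size `V`. Instead the vectors are
split into means, of size at most `G`, and centred noise, which is orthogonal across rounds
(`integral_inner_noise_noise`). A sum of `d` loss vectors then has expected norm at most `3dG/2 +
2V²/G`: the delay multiplies `G` only, and the noise contributes a delay-free term
(`integral_norm_sum_lossVec_le`). A recursion over the iterates turns this into a drift bound
(`integral_drift_le`).

Summation. The sum of `d*_s/(rank s + 1)` is controlled by `σ_max ln T` through an exchange of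
summation and by `√d_tot` through a cut at rank `√d_tot` (`sum_dualDelay_div_le`). The choice of `φ`
balances `V² ln T/λ` against the total bias. All random quantities are continuous functions on a
compact product of spheres, which settles integrability. -/

namespace DelayedBCO

/-! ### The uniform distribution on the sphere: isometry invariance and second moments. -/

section Sphere

variable {k : ℕ}

/-- The action of a linear isometry on the unit sphere. -/
noncomputable def sphereMap (φ : Vec k ≃ₗᵢ[ℝ] Vec k) (u : UnitSphere k) : UnitSphere k :=
  ⟨φ u, by simp⟩

lemma continuous_sphereMap (φ : Vec k ≃ₗᵢ[ℝ] Vec k) : Continuous (sphereMap φ) :=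
  Continuous.subtype_mk (φ.continuous.comp continuous_subtype_val) _

lemma norm_coe_unitSphere (u : UnitSphere k) : ‖(u : Vec k)‖ = 1 := by
  simp

-- The surface measure of a set is a multiple of the volume of the cone over it; isometries carry
-- cones to cones and preserve volume.
open scoped Pointwise in
lemma map_sphereMap_toSphere (φ : Vec k ≃ₗᵢ[ℝ] Vec k) :
    (volume : Measure (Vec k)).toSphere.map (sphereMap φ) =
      (volume : Measure (Vec k)).toSphere := by
  ext s hs
  rw [Measure.map_apply (continuous_sphereMap φ).measurable hs,
    Measure.toSphere_apply' _ ((continuous_sphereMap φ).measurable hs),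
    Measure.toSphere_apply' _ hs]
  congr 1
  rw [← MeasurePreserving.measure_preimage_equiv (f := φ.toMeasurableEquiv)
    (LinearIsometryEquiv.measurePreserving φ)
    (Set.Ioo (0 : ℝ) 1 • (Set.image Subtype.val s))]
  congr 1
  ext x
  simp only [Set.mem_smul, Set.mem_image, Set.mem_preimage]
  constructor
  · rintro ⟨a, ha, _, ⟨u, hu, rfl⟩, rfl⟩
    exact ⟨a, ha, _, ⟨sphereMap φ u, hu, rfl⟩, (map_smul φ a (u : Vec k)).symm⟩
  · rintro ⟨a, ha, _, ⟨u, hu, rfl⟩, h⟩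
    refine ⟨a, ha, _, ⟨sphereMap φ.symm u, ?_, rfl⟩, ?_⟩
    · simpa [sphereMap] using hu
    · apply φ.injective
      rw [map_smul]
      simpa [sphereMap] using h

lemma map_sphereMap_unifSphere (φ : Vec k ≃ₗᵢ[ℝ] Vec k) :
    (unifSphere k).map (sphereMap φ) = unifSphere k := by
  rw [unifSphere, Measure.map_smul, map_sphereMap_toSphere]

instance instIsProbabilityMeasureUnifSphere [NeZero k] : IsProbabilityMeasure (unifSphere k) := by
  constructor
  rw [unifSphere, Measure.smul_apply, smul_eq_mul]
  refine ENNReal.inv_mul_cancel ?_ (measure_ne_top _ _)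
  rw [Measure.measure_univ_ne_zero]
  exact Measure.toSphere_ne_zero _

lemma integral_comp_sphereMap (φ : Vec k ≃ₗᵢ[ℝ] Vec k) {E : Type*} [NormedAddCommGroup E]
    [NormedSpace ℝ E] [SecondCountableTopology E] {F : UnitSphere k → E} (hF : Continuous F) :
    ∫ u, F (sphereMap φ u) ∂unifSphere k = ∫ u, F u ∂unifSphere k := by
  conv_rhs => rw [← map_sphereMap_unifSphere φ]
  rw [integral_map (continuous_sphereMap φ).aemeasurable]
  exact (hF.stronglyMeasurable).aestronglyMeasurable

lemma integrable_of_continuous_of_compact {X E : Type*} [TopologicalSpace X] [CompactSpace X]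
    [MeasurableSpace X] [OpensMeasurableSpace X] [NormedAddCommGroup E]
    [SecondCountableTopologyEither X E] {μ : Measure X} [IsFiniteMeasure μ] {F : X → E}
    (hF : Continuous F) : Integrable F μ :=
  hF.integrable_of_hasCompactSupport (HasCompactSupport.of_compactSpace F)

/-- The reflection in the hyperplane bisecting `y` and `y'` exchanges the two vectors and preserves
the law. -/
lemma integral_inner_sq_eq_of_norm_eq {y y' : Vec k} (h : ‖y‖ = ‖y'‖) :
    ∫ u : UnitSphere k, (inner ℝ (u : Vec k) y) ^ 2 ∂unifSphere k =
      ∫ u : UnitSphere k, (inner ℝ (u : Vec k) y') ^ 2 ∂unifSphere k := by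
  have hφ : (Submodule.span ℝ {y - y'})ᗮ.reflection y = y' := Submodule.reflection_sub h
  rw [← integral_comp_sphereMap (Submodule.span ℝ {y - y'})ᗮ.reflection
    (F := fun u : UnitSphere k => (inner ℝ (u : Vec k) y') ^ 2) (by fun_prop)]
  congr 1 with u
  have := LinearIsometryEquiv.inner_map_map (Submodule.span ℝ {y - y'})ᗮ.reflection (u : Vec k) y
  rw [hφ] at this
  rw [← this, sphereMap]

/-- The second moments of the uniform distribution on the unit sphere of `ℝ^k`. -/
lemma integral_inner_sq [NeZero k] (y : Vec k) :
    (k : ℝ) * ∫ u : UnitSphere k, (inner ℝ (u : Vec k) y) ^ 2 ∂unifSphere k = ‖y‖ ^ 2 := by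
  let b := EuclideanSpace.basisFun (Fin k) ℝ
  -- Each rescaled basis vector gives the same moment as `y`, and summing over the basis produces
  -- `‖u‖² = 1`.
  have h1 : ∀ i, ∫ u : UnitSphere k, (inner ℝ (u : Vec k) y) ^ 2 ∂unifSphere k =
      ∫ u : UnitSphere k, (inner ℝ (u : Vec k) (‖y‖ • b i)) ^ 2 ∂unifSphere k := fun i =>
    integral_inner_sq_eq_of_norm_eq (by simp [norm_smul, b])
  calc (k : ℝ) * ∫ u : UnitSphere k, (inner ℝ (u : Vec k) y) ^ 2 ∂unifSphere k
      = ∑ i : Fin k, ∫ u : UnitSphere k, (inner ℝ (u : Vec k) (‖y‖ • b i)) ^ 2 ∂unifSphere k := by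
        rw [← Finset.sum_congr rfl fun i _ => h1 i]; simp
    _ = ∫ u : UnitSphere k, ∑ i : Fin k, (inner ℝ (u : Vec k) (‖y‖ • b i)) ^ 2 ∂unifSphere k := by
        rw [integral_finsetSum]
        intro i _
        exact integrable_of_continuous_of_compact (by fun_prop)
    _ = ∫ _u : UnitSphere k, ‖y‖ ^ 2 ∂unifSphere k := by
        congr 1 with u
        have := b.sum_sq_norm_inner_left (u : Vec k)
        simp only [inner_smul_right, mul_pow, ← Finset.mul_sum]
        simp only [Real.norm_eq_abs, sq_abs, norm_coe_unitSphere] at this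
        rw [this]; ring
    _ = ‖y‖ ^ 2 := by simp

end Sphere

/-! ### Strongly convex losses and the one-point gradient estimator. -/

/-- `g` is a selection of subgradients of norm at most `G` that witnesses the `lam`-strong convexity
of `f` on `K`. -/
structure SubgradientData {k : ℕ} (K : Set (Vec k)) (G lam : ℝ) (f : Vec k → ℝ)
    (g : Vec k → Vec k) : Prop where
  norm_le : ∀ x ∈ K, ‖g x‖ ≤ G
  strong : ∀ x ∈ K, ∀ y ∈ K, f x + inner ℝ (g x) (y - x) + lam / 2 * ‖y - x‖ ^ 2 ≤ f y

namespace SubgradientData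

variable {k : ℕ} {K : Set (Vec k)} {G lam : ℝ} {f : Vec k → ℝ} {g : Vec k → Vec k}

lemma sub_le_inner (h : SubgradientData K G lam f g) (hlam : 0 ≤ lam) {x y : Vec k} (hx : x ∈ K)
    (hy : y ∈ K) : f x - f y ≤ inner ℝ (g x) (x - y) := by
  have := h.strong x hx y hy
  have h2 : inner ℝ (g x) (y - x) = - inner ℝ (g x) (x - y) := by
    rw [← inner_neg_right, neg_sub]
  have : 0 ≤ lam / 2 * ‖y - x‖ ^ 2 := by positivity
  linarith

lemma inner_le (h : SubgradientData K G lam f g) {x : Vec k} (hx : x ∈ K) (y : Vec k) :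
    inner ℝ (g x) y ≤ G * ‖y‖ :=
  (real_inner_le_norm _ _).trans (mul_le_mul_of_nonneg_right (h.norm_le x hx) (norm_nonneg _))

lemma sub_le (h : SubgradientData K G lam f g) (hlam : 0 ≤ lam) {x y : Vec k} (hx : x ∈ K)
    (hy : y ∈ K) : f x - f y ≤ G * ‖x - y‖ :=
  (h.sub_le_inner hlam hx hy).trans (h.inner_le hx _)

lemma abs_sub_le (h : SubgradientData K G lam f g) (hlam : 0 ≤ lam) {x y : Vec k} (hx : x ∈ K)
    (hy : y ∈ K) : |f x - f y| ≤ G * ‖x - y‖ := by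
  rw [abs_le]
  have h1 := h.sub_le hlam hx hy
  have h2 := h.sub_le hlam hy hx
  rw [norm_sub_rev] at h2
  constructor <;> linarith

/-- Adding the strong convexity inequalities from `x` to `y` and from `y` to `x` cancels the
function values and leaves `λ‖x - y‖² ≤ 2G‖x - y‖`. This bounds the diameter of `K`. -/
lemma norm_sub_le (h : SubgradientData K G lam f g) (hlam : 0 < lam) {x y : Vec k} (hx : x ∈ K)
    (hy : y ∈ K) : ‖x - y‖ ≤ 2 * G / lam := by
  have h1 := h.strong x hx y hy
  have h2 := h.strong y hy x hx
  have h3 := h.inner_le hy (y - x)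
  have h4 := h.inner_le hx (x - y)
  have e1 : inner ℝ (g x) (y - x) = - inner ℝ (g x) (x - y) := by
    rw [← inner_neg_right, neg_sub]
  have e2 : inner ℝ (g y) (x - y) = - inner ℝ (g y) (y - x) := by
    rw [← inner_neg_right, neg_sub]
  rw [norm_sub_rev] at h1 h3
  rw [le_div_iff₀ hlam]
  rcases (norm_nonneg (x - y)).eq_or_lt with h0 | h0
  · rw [← h0, zero_mul]
    have := (norm_nonneg _).trans (h.norm_le x hx)
    linarith
  · nlinarith

/-- The one-point estimator averages subgradients over the ball of radius `δ`: its mean satisfies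
every upper bound that holds for the subgradients on that ball. -/
lemma inner_onePoint_le [NeZero k] (h : SubgradientData K G lam f g) (hlam : 0 ≤ lam) {δ : ℝ}
    (hδ : 0 < δ) {w : Vec k} (hw : Metric.closedBall w δ ⊆ K)
    (hcont : Continuous fun u : UnitSphere k => f (w + δ • (u : Vec k))) {y : Vec k} {Q : ℝ}
    (hQ : ∀ p ∈ Metric.closedBall w δ, inner ℝ (g p) y ≤ Q) :
    inner ℝ (∫ u : UnitSphere k, ((k : ℝ) / δ * f (w + δ • (u : Vec k))) • (u : Vec k)
      ∂unifSphere k) y ≤ Q := by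
  rcases eq_or_ne y 0 with rfl | hy
  · simpa using hQ w (Metric.mem_closedBall_self hδ.le)
  have hy' : 0 < ‖y‖ := norm_pos_iff.2 hy
  -- The reflection `φ` reverses the component along `y`. Since `u` and `φ u` have the same law, the
  -- estimator can be symmetrized into differences of `f` along `y`, so neither the divergence
  -- theorem nor a derivative of the smoothed loss is needed.
  set φ := (Submodule.span ℝ {y})ᗮ.reflection with hφ
  have hφu : ∀ u : Vec k, φ u = u - (2 * inner ℝ u y / ‖y‖ ^ 2) • y := by
    intro u
    rw [hφ, Submodule.reflection_orthogonal_apply, Submodule.reflection_singleton_apply]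
    simp only [RCLike.ofReal_real_eq_id, id_eq, real_inner_comm, neg_sub]
    rw [← smul_assoc]
    simp only [nsmul_eq_mul, Nat.cast_ofNat]
    congr 2
    ring
  have hφi : ∀ u : Vec k, inner ℝ (φ u) y = - inner ℝ u y := by
    intro u
    rw [hφu, inner_sub_left, inner_smul_left, real_inner_self_eq_norm_sq]
    simp only [conj_trivial]
    field_simp
    ring
  have hmem : ∀ u : UnitSphere k, w + δ • (u : Vec k) ∈ Metric.closedBall w δ := by
    intro u
    simp [norm_smul, abs_of_pos hδ]
  have hlin : ∀ u : UnitSphere k, (f (w + δ • (u : Vec k)) - f (w + δ • φ u)) *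
      inner ℝ (u : Vec k) y ≤ 2 * δ / ‖y‖ ^ 2 * Q * (inner ℝ (u : Vec k) y) ^ 2 := by
    intro u
    set a := inner ℝ (u : Vec k) y with ha
    have hm1 := hmem u
    have hm2 : w + δ • φ u ∈ Metric.closedBall w δ := hmem (sphereMap φ u)
    -- The subgradient is taken at the endpoint further along `y`, so that `p - q` is a nonnegative
    -- multiple of `y` and `Q` may have either sign.
    have key : ∀ p q : Vec k, p ∈ Metric.closedBall w δ → q ∈ Metric.closedBall w δ → ∀ b : ℝ,
        0 ≤ b → p - q = (2 * δ * b / ‖y‖ ^ 2) • y →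
        (f p - f q) * b ≤ 2 * δ / ‖y‖ ^ 2 * Q * b ^ 2 := by
      intro p q hp hq b hb hpq
      have h1 := h.sub_le_inner hlam (hw hp) (hw hq)
      rw [hpq, inner_smul_right] at h1
      have h2 : 2 * δ * b / ‖y‖ ^ 2 * inner ℝ (g p) y ≤ 2 * δ * b / ‖y‖ ^ 2 * Q :=
        mul_le_mul_of_nonneg_left (hQ p hp) (by positivity)
      calc (f p - f q) * b ≤ (2 * δ * b / ‖y‖ ^ 2 * Q) * b :=
            mul_le_mul_of_nonneg_right (h1.trans h2) hb
        _ = _ := by ring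
    rcases le_total 0 a with h0 | h0
    · apply key _ _ hm1 hm2 a h0
      rw [hφu, ← ha]
      simp only [smul_sub, smul_smul]
      rw [show δ * (2 * a / ‖y‖ ^ 2) = 2 * δ * a / ‖y‖ ^ 2 by ring]
      abel
    · have := key _ _ hm2 hm1 (-a) (by linarith) (by
        rw [hφu, ← ha]
        simp only [smul_sub, smul_smul]
        rw [show 2 * δ * -a / ‖y‖ ^ 2 = - (δ * (2 * a / ‖y‖ ^ 2)) by ring, neg_smul]
        abel)
      nlinarith
  have hF : Continuous fun u : UnitSphere k =>
      ((k : ℝ) / δ * f (w + δ • (u : Vec k))) • (u : Vec k) :=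
    (continuous_const.mul hcont).smul continuous_subtype_val
  have hA : Continuous fun u : UnitSphere k => f (w + δ • (u : Vec k)) * inner ℝ (u : Vec k) y :=
    hcont.mul (by fun_prop)
  have hB : Continuous fun u : UnitSphere k => f (w + δ • φ u) * inner ℝ (u : Vec k) y :=
    (hcont.comp (continuous_sphereMap φ)).mul (by fun_prop)
  have e1 : inner ℝ (∫ u : UnitSphere k, ((k : ℝ) / δ * f (w + δ • (u : Vec k))) • (u : Vec k)
      ∂unifSphere k) y = (k : ℝ) / δ * ∫ u : UnitSphere k, f (w + δ • (u : Vec k)) *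
        inner ℝ (u : Vec k) y ∂unifSphere k := by
    rw [real_inner_comm, ← integral_inner (integrable_of_continuous_of_compact hF),
      ← integral_const_mul]
    congr 1 with u
    rw [inner_smul_right, real_inner_comm]
    ring
  have e2 : ∫ u : UnitSphere k, f (w + δ • φ u) * inner ℝ (u : Vec k) y ∂unifSphere k =
      - ∫ u : UnitSphere k, f (w + δ • (u : Vec k)) * inner ℝ (u : Vec k) y ∂unifSphere k := by
    rw [← integral_comp_sphereMap φ hA, ← integral_neg]
    congr 1 with u
    simp only [sphereMap]
    rw [hφi]; ring
  have e3 : 2 * ∫ u : UnitSphere k, f (w + δ • (u : Vec k)) * inner ℝ (u : Vec k) y ∂unifSphere k =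
      ∫ u : UnitSphere k, (f (w + δ • (u : Vec k)) - f (w + δ • φ u)) *
        inner ℝ (u : Vec k) y ∂unifSphere k := by
    simp only [sub_mul]
    rw [integral_sub (integrable_of_continuous_of_compact hA)
      (integrable_of_continuous_of_compact hB), e2]
    ring
  have e4 : ∫ u : UnitSphere k, (f (w + δ • (u : Vec k)) - f (w + δ • φ u)) *
        inner ℝ (u : Vec k) y ∂unifSphere k ≤
      ∫ u : UnitSphere k, 2 * δ / ‖y‖ ^ 2 * Q * (inner ℝ (u : Vec k) y) ^ 2 ∂unifSphere k := by
    apply integral_mono _ _ hlin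
    · simp only [sub_mul]
      exact integrable_of_continuous_of_compact (hA.sub hB)
    · exact integrable_of_continuous_of_compact (by fun_prop)
  rw [integral_const_mul] at e4
  have e5 := integral_inner_sq y
  set I := ∫ u : UnitSphere k, (inner ℝ (u : Vec k) y) ^ 2 ∂unifSphere k
  rw [e1]
  -- The second moment `k * I = ‖y‖²` cancels the dimension factor of the estimator exactly.
  calc (k : ℝ) / δ * ∫ u : UnitSphere k, f (w + δ • (u : Vec k)) * inner ℝ (u : Vec k) y
        ∂unifSphere k
      ≤ (k : ℝ) / δ * (2 * δ / ‖y‖ ^ 2 * Q * I / 2) :=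
        mul_le_mul_of_nonneg_left (by linarith) (by positivity)
    _ = (k * I) / ‖y‖ ^ 2 * Q := by field_simp
    _ = Q := by rw [e5]; field_simp

/-- The mean is tested against itself. -/
lemma norm_onePoint_le [NeZero k] (h : SubgradientData K G lam f g) (hlam : 0 ≤ lam) {δ : ℝ}
    (hδ : 0 < δ) {w : Vec k} (hw : Metric.closedBall w δ ⊆ K)
    (hcont : Continuous fun u : UnitSphere k => f (w + δ • (u : Vec k))) :
    ‖∫ u : UnitSphere k, ((k : ℝ) / δ * f (w + δ • (u : Vec k))) • (u : Vec k)
      ∂unifSphere k‖ ≤ G := by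
  set c := ∫ u : UnitSphere k, ((k : ℝ) / δ * f (w + δ • (u : Vec k))) • (u : Vec k) ∂unifSphere k
  have h1 : inner ℝ c c ≤ G * ‖c‖ :=
    h.inner_onePoint_le hlam hδ hw hcont fun p hp => h.inner_le (hw hp) _
  rw [real_inner_self_eq_norm_sq] at h1
  rcases (norm_nonneg c).eq_or_lt with h0 | h0
  · rw [← h0]
    exact (norm_nonneg _).trans (h.norm_le w (hw (Metric.mem_closedBall_self hδ.le)))
  · nlinarith

lemma radius_le [NeZero k] (h : SubgradientData K G lam f g) (hlam : 0 < lam) {r : ℝ}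
    (hr : 0 < r) (hrK : Metric.closedBall 0 r ⊆ K) : r ≤ 2 * G / lam := by
  obtain ⟨v, hv⟩ := exists_norm_eq (Vec k) hr.le
  have h1 := h.norm_sub_le hlam (x := v) (y := 0) (hrK (by simp [hv])) (hrK (by simp [hr.le]))
  rwa [sub_zero, hv] at h1

/-- Instantaneous regret of any point of the ball of radius `δ` in terms of the mean of the
one-point estimator. -/
lemma sub_le_inner_onePoint [NeZero k] (h : SubgradientData K G lam f g) (hlam : 0 < lam)
    {δ r : ℝ} (hδ : 0 < δ) (hr : 0 < r) (hrK : Metric.closedBall 0 r ⊆ K) {z v x : Vec k}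
    (hz : z ∈ K) (hv : v ∈ K)
    (hw : Metric.closedBall ((1 - δ / r) • z) δ ⊆ K)
    (hcont : Continuous fun u : UnitSphere k => f ((1 - δ / r) • z + δ • (u : Vec k)))
    (hx : x ∈ Metric.closedBall ((1 - δ / r) • z) δ) :
    f x - f v ≤ inner ℝ (∫ u : UnitSphere k,
        ((k : ℝ) / δ * f ((1 - δ / r) • z + δ • (u : Vec k))) • (u : Vec k) ∂unifSphere k) (z - v)
      - lam / 2 * ‖z - v‖ ^ 2 + 16 * (δ / r) * (G ^ 2 / lam) := by
  set q := δ / r with hq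
  set D := 2 * G / lam with hD
  have hq0 : 0 < q := div_pos hδ hr
  have hrD : r ≤ D := h.radius_le hlam hr hrK
  have h0K : (0 : Vec k) ∈ K := hrK (by simp [hr.le])
  have hG : 0 ≤ G := (norm_nonneg _).trans (h.norm_le 0 h0K)
  have hlD : lam * D = 2 * G := by rw [hD]; field_simp
  have hδq : δ = q * r := by rw [hq]; field_simp
  -- At each `p` in the ball, strong convexity compares `f p` with `f v`. Passing from `f p` to `f
  -- x` costs `2qGD`, replacing `v - p` by `v - z` in the inner product costs `2qGD`, and in the
  -- square `4qGD`: in total `8qGD = 16qG²/λ`.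
  have key := h.inner_onePoint_le hlam.le hδ hw hcont (y := v - z)
    (Q := f v - f x - lam / 2 * ‖z - v‖ ^ 2 + 8 * q * (G * D)) (by
      intro p hp
      have hpK := hw hp
      have h1 := h.strong p hpK v hv
      have hpz : ‖p - z‖ ≤ 2 * (q * D) := by
        have e : p - z = (p - (1 - q) • z) - q • z := by
          rw [sub_smul, one_smul]; abel
        have hzD := h.norm_sub_le hlam hz h0K
        rw [sub_zero] at hzD
        rw [e]
        calc _ ≤ ‖p - (1 - q) • z‖ + ‖q • z‖ := _root_.norm_sub_le _ _
          _ ≤ δ + q * D := by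
            apply add_le_add
            · simpa [dist_eq_norm] using hp
            · rw [norm_smul, Real.norm_eq_abs, abs_of_pos hq0]
              exact mul_le_mul_of_nonneg_left hzD hq0.le
          _ ≤ _ := by nlinarith
      have hpx : ‖x - p‖ ≤ 2 * (q * D) := by
        have e : x - p = (x - (1 - q) • z) - (p - (1 - q) • z) := by abel
        rw [e]
        calc _ ≤ ‖x - (1 - q) • z‖ + ‖p - (1 - q) • z‖ := _root_.norm_sub_le _ _
          _ ≤ δ + δ := by
            apply add_le_add
            · simpa [dist_eq_norm] using hx
            · simpa [dist_eq_norm] using hp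
          _ ≤ _ := by nlinarith
      have h2 : f x - f p ≤ G * (2 * (q * D)) :=
        (h.sub_le hlam.le (hw hx) hpK).trans (mul_le_mul_of_nonneg_left hpx hG)
      have h3 : inner ℝ (g p) (p - z) ≤ G * (2 * (q * D)) :=
        (h.inner_le hpK _).trans (mul_le_mul_of_nonneg_left hpz hG)
      have h4 : inner ℝ (g p) (v - z) = inner ℝ (g p) (v - p) + inner ℝ (g p) (p - z) := by
        rw [← inner_add_right]; congr 1; abel
      have h5 : ‖z - v‖ ≤ ‖v - p‖ + 2 * (q * D) := by
        have e : z - v = - ((v - p) + (p - z)) := by abel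
        rw [e, norm_neg]
        exact (norm_add_le _ _).trans (by linarith)
      have h6 := h.norm_sub_le hlam hz hv
      have h7 := h.norm_sub_le hlam hv hpK
      have h8 : ‖z - v‖ ^ 2 - ‖v - p‖ ^ 2 ≤ 2 * (q * D) * (2 * D) := by
        have a1 := norm_nonneg (z - v)
        have a2 := norm_nonneg (v - p)
        have : ‖z - v‖ ^ 2 - ‖v - p‖ ^ 2 = (‖z - v‖ - ‖v - p‖) * (‖z - v‖ + ‖v - p‖) := by ring
        rw [this]
        have hqD : 0 ≤ 2 * (q * D) := by
          have : 0 ≤ D := hr.le.trans hrD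
          positivity
        calc _ ≤ 2 * (q * D) * (‖z - v‖ + ‖v - p‖) :=
              mul_le_mul_of_nonneg_right (by linarith) (by positivity)
          _ ≤ _ := mul_le_mul_of_nonneg_left (by linarith) hqD
      have h9 : lam / 2 * (‖z - v‖ ^ 2 - ‖v - p‖ ^ 2) ≤ 4 * q * (G * D) := by
        calc _ ≤ lam / 2 * (2 * (q * D) * (2 * D)) :=
              mul_le_mul_of_nonneg_left h8 (by positivity)
          _ = 2 * q * D * (lam * D) := by ring
          _ = _ := by rw [hlD]; ring
      rw [h4]
      linarith)
  have e : inner ℝ (∫ u : UnitSphere k,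
        ((k : ℝ) / δ * f ((1 - q) • z + δ • (u : Vec k))) • (u : Vec k) ∂unifSphere k) (v - z) =
      - inner ℝ (∫ u : UnitSphere k,
        ((k : ℝ) / δ * f ((1 - q) • z + δ • (u : Vec k))) • (u : Vec k) ∂unifSphere k) (z - v) := by
    rw [← inner_neg_right, neg_sub]
  rw [e] at key
  have e2 : 8 * q * (G * D) = 16 * q * (G ^ 2 / lam) := by rw [hD]; ring
  linarith

end SubgradientData

/-! ### P-FTRL: regret, drift and continuous dependence on the losses. -/

section FTRL

variable {k : ℕ}

/-- The learning rates `η_n = 1 / (n λ)`. -/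
noncomputable abbrev strongRate (lam : ℝ) : ℕ → ℝ := fun n => 1 / (n * lam)

lemma proxWeight_strongRate {lam : ℝ} (n : ℕ) :
    proxWeight (strongRate lam) (n + 1) = lam := by
  unfold proxWeight strongRate
  split_ifs with h
  · obtain rfl : n = 0 := by omega
    simp
  · simp only [one_div, inv_inv, Nat.add_sub_cancel]
    push_cast
    ring

/-- The states of P-FTRL along the sequence of loss vectors `c`. -/
noncomputable def ftrlState (K : Set (Vec k)) (lam : ℝ) (z₁ : Vec k) (c : ℕ → Vec k) :
    ℕ → FTRLState k
  | 0 => FTRLState.init z₁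
  | m + 1 => (ftrlState K lam z₁ c m).update K (strongRate lam) (c m)

/-- The prediction of P-FTRL after `m` updates. -/
noncomputable def ftrlIter (K : Set (Vec k)) (lam : ℝ) (z₁ : Vec k) (c : ℕ → Vec k) (m : ℕ) :
    Vec k :=
  (ftrlState K lam z₁ c m).z

/-- The P-FTRL objective after `m` updates. -/
noncomputable def ftrlObj (K : Set (Vec k)) (lam : ℝ) (z₁ : Vec k) (c : ℕ → Vec k) (m : ℕ)
    (z : Vec k) : ℝ :=
  ∑ j ∈ Finset.range m, (inner ℝ (c j) z + lam / 2 * ‖ftrlIter K lam z₁ c j - z‖ ^ 2)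

variable {K : Set (Vec k)} {lam : ℝ} {z₁ : Vec k} {c : ℕ → Vec k}

lemma ftrlState_n (m : ℕ) : (ftrlState K lam z₁ c m).n = m := by
  induction m with
  | zero => rfl
  | succ m ih => simp [ftrlState, FTRLState.update, ih]

lemma ftrlState_obj (m : ℕ) : (ftrlState K lam z₁ c m).obj = ftrlObj K lam z₁ c m := by
  induction m with
  | zero => ext z; simp [ftrlState, FTRLState.init, ftrlObj]
  | succ m ih =>
    ext z
    simp only [ftrlState, FTRLState.update, ih, ftrlState_n, proxWeight_strongRate]
    rw [ftrlObj, ftrlObj, Finset.sum_range_succ]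
    rfl

lemma ftrlIter_succ (m : ℕ) :
    ftrlIter K lam z₁ c (m + 1) = argminOn K (ftrlObj K lam z₁ c (m + 1)) := by
  rw [← ftrlState_obj]
  rfl

lemma continuous_ftrlObj (m : ℕ) : Continuous (ftrlObj K lam z₁ c m) := by
  unfold ftrlObj
  fun_prop

lemma ftrlIter_spec (hK : IsCompact K) (hz₁ : z₁ ∈ K) (m : ℕ) :
    ftrlIter K lam z₁ c m ∈ K ∧ IsMinOn (ftrlObj K lam z₁ c m) K (ftrlIter K lam z₁ c m) := by
  cases m with
  | zero =>
    -- The empty objective vanishes, so the arbitrary starting point is already a minimizer.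
    refine ⟨hz₁, fun z _ => ?_⟩
    simp [ftrlObj]
  | succ m =>
    rw [ftrlIter_succ]
    have := hK.exists_isMinOn ⟨z₁, hz₁⟩ (continuous_ftrlObj (lam := lam) (z₁ := z₁) (c := c)
      (K := K) (m + 1)).continuousOn
    exact Classical.epsilon_spec this

lemma ftrlIter_mem (hK : IsCompact K) (hz₁ : z₁ ∈ K) (m : ℕ) : ftrlIter K lam z₁ c m ∈ K :=
  (ftrlIter_spec hK hz₁ m).1

lemma ftrlIter_congr {c' : ℕ → Vec k} {m : ℕ} (h : ∀ j < m, c j = c' j) :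
    ftrlIter K lam z₁ c m = ftrlIter K lam z₁ c' m := by
  have : ftrlState K lam z₁ c m = ftrlState K lam z₁ c' m := by
    induction m with
    | zero => rfl
    | succ m ih =>
      rw [ftrlState, ftrlState, ih fun j hj => h j (by omega), h m (by omega)]
  rw [ftrlIter, this, ftrlIter]

lemma norm_sub_convexComb_sq (a x d : Vec k) (t : ℝ) :
    ‖a - (x + t • d)‖ ^ 2 =
      (1 - t) * ‖a - x‖ ^ 2 + t * ‖a - (x + d)‖ ^ 2 - t * (1 - t) * ‖d‖ ^ 2 := by
  have e1 : a - (x + t • d) = (a - x) - t • d := by abel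
  have e2 : a - (x + d) = (a - x) - d := by abel
  rw [e1, e2, norm_sub_sq_real (a - x) (t • d), norm_sub_sq_real (a - x) d, inner_smul_right,
    norm_smul, mul_pow, Real.norm_eq_abs, sq_abs]
  ring

/-- The objective is affine plus `m` squared distances weighted by `lam / 2`, so its convexity
defect is an exact identity. -/
lemma ftrlObj_convexComb (m : ℕ) (x d : Vec k) (t : ℝ) :
    ftrlObj K lam z₁ c m (x + t • d) = (1 - t) * ftrlObj K lam z₁ c m x +
      t * ftrlObj K lam z₁ c m (x + d) - m * lam / 2 * (t * (1 - t) * ‖d‖ ^ 2) := by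
  have : (m : ℝ) * lam / 2 * (t * (1 - t) * ‖d‖ ^ 2) =
      ∑ _j ∈ Finset.range m, lam / 2 * (t * (1 - t) * ‖d‖ ^ 2) := by
    rw [Finset.sum_const, Finset.card_range, nsmul_eq_mul]; ring
  rw [this]
  unfold ftrlObj
  rw [Finset.mul_sum, Finset.mul_sum, ← Finset.sum_add_distrib, ← Finset.sum_sub_distrib]
  refine Finset.sum_congr rfl fun j _ => ?_
  rw [norm_sub_convexComb_sq, inner_add_right, inner_add_right, inner_smul_right]
  ring

/-- Quadratic growth of the P-FTRL objective around its minimizer. -/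
lemma ftrlObj_add_sq_le (hK : IsCompact K) (hconv : Convex ℝ K) (hlam : 0 < lam) (hz₁ : z₁ ∈ K)
    (m : ℕ) {z : Vec k} (hz : z ∈ K) :
    ftrlObj K lam z₁ c m (ftrlIter K lam z₁ c m) +
      m * lam / 2 * ‖z - ftrlIter K lam z₁ c m‖ ^ 2 ≤ ftrlObj K lam z₁ c m z := by
  obtain ⟨hmem, hmin⟩ := ftrlIter_spec (lam := lam) (c := c) hK hz₁ m
  set x := ftrlIter K lam z₁ c m
  set F := ftrlObj K lam z₁ c m with hF
  set B := (m : ℝ) * lam / 2 * ‖z - x‖ ^ 2 with hB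
  have hB0 : 0 ≤ B := by positivity
  -- Minimality is used at `x + t • (z - x)` and divided by `t`; the full quadratic growth appears
  -- as `t` tends to `0`.
  have key : ∀ t : ℝ, 0 < t → t ≤ 1 → F x + (1 - t) * B ≤ F z := by
    intro t ht ht1
    have h1 : x + t • (z - x) ∈ K := hconv.add_smul_sub_mem hmem hz ⟨ht.le, ht1⟩
    have h2 : F x ≤ F (x + t • (z - x)) := hmin h1
    rw [hF, ftrlObj_convexComb, add_sub_cancel, ← hF] at h2
    have h3 : t * (F x + (1 - t) * B) ≤ t * F z := by rw [hB]; nlinarith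
    exact le_of_mul_le_mul_left h3 ht
  refine le_of_forall_pos_le_add fun ε hε => ?_
  have hpos : 0 < ε / (B + 1) := by positivity
  have h1 := key (min 1 (ε / (B + 1))) (lt_min one_pos hpos) (min_le_left _ _)
  have h2 : min 1 (ε / (B + 1)) * B ≤ ε := by
    calc _ ≤ ε / (B + 1) * B := mul_le_mul_of_nonneg_right (min_le_right _ _) hB0
      _ ≤ ε / (B + 1) * (B + 1) := mul_le_mul_of_nonneg_left (by linarith) hpos.le
      _ = ε := by field_simp
  linarith

/-- Induction on the optimal value. The old objective grows with modulus `m λ` around its minimizer,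
and the new proximal term is centred at the same point, so moving to the next iterate costs `(m+1)
λ/2` times the squared step. The gain from `c m` is absorbed by completing the square. -/
lemma sum_inner_ftrlIter_le (hK : IsCompact K) (hconv : Convex ℝ K) (hlam : 0 < lam)
    (hz₁ : z₁ ∈ K) (m : ℕ) :
    ∑ j ∈ Finset.range m, (inner ℝ (c j) (ftrlIter K lam z₁ c j) - ‖c j‖ ^ 2 / (2 * (j + 1) * lam))
      ≤ ftrlObj K lam z₁ c m (ftrlIter K lam z₁ c m) := by
  induction m with
  | zero => simp [ftrlObj]
  | succ m ih =>
    rw [Finset.sum_range_succ]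
    have h1 := ftrlObj_add_sq_le (c := c) hK hconv hlam hz₁ m
      (ftrlIter_mem (c := c) (lam := lam) hK hz₁ (m + 1))
    have h2 : ftrlObj K lam z₁ c (m + 1) (ftrlIter K lam z₁ c (m + 1)) =
        ftrlObj K lam z₁ c m (ftrlIter K lam z₁ c (m + 1)) +
        (inner ℝ (c m) (ftrlIter K lam z₁ c (m + 1)) +
          lam / 2 * ‖ftrlIter K lam z₁ c m - ftrlIter K lam z₁ c (m + 1)‖ ^ 2) := by
      rw [ftrlObj, Finset.sum_range_succ]; rfl
    rw [h2]
    set x := ftrlIter K lam z₁ c m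
    set y := ftrlIter K lam z₁ c (m + 1)
    rw [norm_sub_rev x y]
    have h3 : inner ℝ (c m) x - inner ℝ (c m) y ≤ ‖c m‖ * ‖y - x‖ := by
      rw [← inner_sub_right, norm_sub_rev]
      exact real_inner_le_norm _ _
    have h4 : ‖c m‖ * ‖y - x‖ - ‖c m‖ ^ 2 / (2 * (m + 1) * lam) ≤
        (m + 1) * lam / 2 * ‖y - x‖ ^ 2 := by
      rw [sub_le_iff_le_add, ← sub_nonneg]
      have : (m + 1) * lam / 2 * ‖y - x‖ ^ 2 + ‖c m‖ ^ 2 / (2 * (m + 1) * lam) -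
          ‖c m‖ * ‖y - x‖ = ((m + 1) * lam * ‖y - x‖ - ‖c m‖) ^ 2 / (2 * (m + 1) * lam) := by
        field_simp
        ring
      rw [this]
      positivity
    linarith

/-- The regret bound of P-FTRL for the quadratic surrogate losses. -/
lemma ftrl_regret_le (hK : IsCompact K) (hconv : Convex ℝ K) (hlam : 0 < lam)
    (hz₁ : z₁ ∈ K) (m : ℕ) {v : Vec k} (hv : v ∈ K) :
    ∑ j ∈ Finset.range m, (inner ℝ (c j) (ftrlIter K lam z₁ c j - v) -
        lam / 2 * ‖ftrlIter K lam z₁ c j - v‖ ^ 2) ≤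
      ∑ j ∈ Finset.range m, ‖c j‖ ^ 2 / (2 * (j + 1) * lam) := by
  have h1 := sum_inner_ftrlIter_le (c := c) hK hconv hlam hz₁ m
  have h2 : ftrlObj K lam z₁ c m (ftrlIter K lam z₁ c m) ≤ ftrlObj K lam z₁ c m v :=
    (ftrlIter_spec (lam := lam) (c := c) hK hz₁ m).2 hv
  have h3 := h1.trans h2
  rw [ftrlObj, ← sub_nonpos, ← Finset.sum_sub_distrib] at h3
  rw [← sub_nonpos, ← Finset.sum_sub_distrib]
  refine le_of_eq_of_le (Finset.sum_congr rfl fun j _ => ?_) h3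
  rw [inner_sub_right]
  ring

lemma le_of_mul_le_mul_norm {a b x : ℝ} (hx : 0 ≤ x) (hb : 0 ≤ b) (h : a * x ^ 2 ≤ b * x) :
    a * x ≤ b := by
  rcases hx.eq_or_lt with rfl | h0
  · simpa using hb
  · nlinarith

/-- The distance between two iterates is controlled by the sum of the loss vectors in between. -/
lemma ftrlIter_drift (hK : IsCompact K) (hconv : Convex ℝ K) (hlam : 0 < lam)
    (hz₁ : z₁ ∈ K) {n m : ℕ} (hnm : n ≤ m) :
    m * lam * ‖ftrlIter K lam z₁ c m - ftrlIter K lam z₁ c n‖ ≤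
      ‖∑ j ∈ Finset.Ico n m, c j‖ +
        lam * ∑ j ∈ Finset.Ico n m, ‖ftrlIter K lam z₁ c j - ftrlIter K lam z₁ c n‖ := by
  have h1 := ftrlObj_add_sq_le (c := c) hK hconv hlam hz₁ m
      (ftrlIter_mem (c := c) (lam := lam) hK hz₁ n)
  have h2 := ftrlObj_add_sq_le (c := c) hK hconv hlam hz₁ n
      (ftrlIter_mem (c := c) (lam := lam) hK hz₁ m)
  set Z := ftrlIter K lam z₁ c with hZ
  have hsplit : ∀ z, ftrlObj K lam z₁ c m z = ftrlObj K lam z₁ c n z +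
      ∑ j ∈ Finset.Ico n m, (inner ℝ (c j) z + lam / 2 * ‖Z j - z‖ ^ 2) := fun z => by
    simp only [ftrlObj]
    rw [Finset.sum_range_add_sum_Ico _ hnm]
  rw [hsplit, hsplit] at h1
  -- Adding the two growth inequalities gives the coefficient `(m + n) λ/2`. Expanding the squares
  -- around `Z n` gives a further `(m - n) λ/2`, which raises it to `m λ`.
  have h3 : ∑ j ∈ Finset.Ico n m, (inner ℝ (c j) (Z n) + lam / 2 * ‖Z j - Z n‖ ^ 2) -
      ∑ j ∈ Finset.Ico n m, (inner ℝ (c j) (Z m) + lam / 2 * ‖Z j - Z m‖ ^ 2) ≤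
      ‖∑ j ∈ Finset.Ico n m, c j‖ * ‖Z m - Z n‖ +
        lam * (∑ j ∈ Finset.Ico n m, ‖Z j - Z n‖) * ‖Z m - Z n‖ -
        ((m : ℝ) - n) * (lam / 2 * ‖Z m - Z n‖ ^ 2) := by
    rw [← Finset.sum_sub_distrib]
    have hc : ((m : ℝ) - n) * (lam / 2 * ‖Z m - Z n‖ ^ 2) =
        ∑ _j ∈ Finset.Ico n m, lam / 2 * ‖Z m - Z n‖ ^ 2 := by
      rw [Finset.sum_const, Nat.card_Ico, nsmul_eq_mul, Nat.cast_sub hnm]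
    have hin : - inner ℝ (∑ j ∈ Finset.Ico n m, c j) (Z m - Z n) ≤
        ‖∑ j ∈ Finset.Ico n m, c j‖ * ‖Z m - Z n‖ := by
      rw [← inner_neg_right, ← norm_neg (Z m - Z n)]
      exact real_inner_le_norm _ _
    rw [hc]
    refine le_trans ?_ (sub_le_sub_right (add_le_add_left hin _) _)
    rw [sum_inner, Finset.mul_sum, Finset.sum_mul, ← Finset.sum_neg_distrib,
      ← Finset.sum_add_distrib, ← Finset.sum_sub_distrib]
    refine Finset.sum_le_sum fun j _ => ?_
    have e : Z j - Z m = (Z j - Z n) - (Z m - Z n) := by abel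
    have h4 := real_inner_le_norm (Z j - Z n) (Z m - Z n)
    rw [e, norm_sub_sq_real (Z j - Z n), inner_sub_right (c j)]
    nlinarith
  apply le_of_mul_le_mul_norm (norm_nonneg _)
    (add_nonneg (norm_nonneg _) (mul_nonneg hlam.le (Finset.sum_nonneg fun _ _ => norm_nonneg _)))
  rw [norm_sub_rev (Z n) (Z m)] at h1
  nlinarith

/-- Quadratic growth of each objective is evaluated at the minimizer of the other. Earlier iterates
appear because the proximal centres depend on the losses as well. -/
lemma ftrlIter_lipschitz (hK : IsCompact K) (hconv : Convex ℝ K) (hlam : 0 < lam)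
    (hz₁ : z₁ ∈ K) (c c' : ℕ → Vec k) (m : ℕ) :
    m * lam * ‖ftrlIter K lam z₁ c m - ftrlIter K lam z₁ c' m‖ ≤
      ∑ j ∈ Finset.range m, (‖c j - c' j‖ +
        lam * ‖ftrlIter K lam z₁ c j - ftrlIter K lam z₁ c' j‖) := by
  have h1 := ftrlObj_add_sq_le (c := c) hK hconv hlam hz₁ m
      (ftrlIter_mem (c := c') (lam := lam) hK hz₁ m)
  have h2 := ftrlObj_add_sq_le (c := c') hK hconv hlam hz₁ m
      (ftrlIter_mem (c := c) (lam := lam) hK hz₁ m)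
  set Z := ftrlIter K lam z₁ c with hZ
  set Z' := ftrlIter K lam z₁ c' with hZ'
  rw [norm_sub_rev] at h1
  have h3 : ftrlObj K lam z₁ c m (Z' m) - ftrlObj K lam z₁ c m (Z m) +
      (ftrlObj K lam z₁ c' m (Z m) - ftrlObj K lam z₁ c' m (Z' m)) ≤
      (∑ j ∈ Finset.range m, (‖c j - c' j‖ + lam * ‖Z j - Z' j‖)) * ‖Z m - Z' m‖ := by
    simp only [ftrlObj]
    rw [← Finset.sum_sub_distrib, ← Finset.sum_sub_distrib, ← Finset.sum_add_distrib,
      Finset.sum_mul]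
    refine Finset.sum_le_sum fun j _ => ?_
    have e1 : inner ℝ (c j - c' j) (Z' m - Z m) ≤ ‖c j - c' j‖ * ‖Z m - Z' m‖ := by
      rw [norm_sub_rev (Z m)]; exact real_inner_le_norm _ _
    have e2 : inner ℝ (Z j - Z' j) (Z m - Z' m) ≤ ‖Z j - Z' j‖ * ‖Z m - Z' m‖ :=
      real_inner_le_norm _ _
    simp only [← hZ, ← hZ', norm_sub_sq_real]
    simp only [inner_sub_left, inner_sub_right] at e1 e2 ⊢
    nlinarith
  apply le_of_mul_le_mul_norm (norm_nonneg _)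
    (Finset.sum_nonneg fun _ _ => add_nonneg (norm_nonneg _) (mul_nonneg hlam.le (norm_nonneg _)))
  nlinarith

/-- Strong induction on `m`: the Lipschitz estimate bounds the change of the `m`-th iterate by
changes of earlier losses and iterates. -/
lemma continuous_ftrlIter {X : Type*} [TopologicalSpace X] (hK : IsCompact K)
    (hconv : Convex ℝ K) (hlam : 0 < lam) (hz₁ : z₁ ∈ K) {c : X → ℕ → Vec k} (m : ℕ)
    (hc : ∀ j < m, Continuous fun u => c u j) :
    Continuous fun u => ftrlIter K lam z₁ (c u) m := by
  induction m using Nat.strong_induction_on with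
  | _ m ih =>
  rcases Nat.eq_zero_or_pos m with rfl | hm
  · exact continuous_const
  have hm' : (0 : ℝ) < m := by exact_mod_cast hm
  rw [continuous_iff_continuousAt]
  intro u₀
  rw [ContinuousAt, tendsto_iff_norm_sub_tendsto_zero]
  have hlim : Continuous fun u => (m * lam)⁻¹ * ∑ j ∈ Finset.range m, (‖c u j - c u₀ j‖ +
        lam * ‖ftrlIter K lam z₁ (c u) j - ftrlIter K lam z₁ (c u₀) j‖) := by
    refine continuous_const.mul (continuous_finsetSum _ fun j hj => ?_)
    rw [Finset.mem_range] at hj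
    have h1 := hc j hj
    have h2 := ih j hj fun i hi => hc i (hi.trans hj)
    fun_prop
  have h0 := hlim.tendsto u₀
  simp only [sub_self, norm_zero, mul_zero, add_zero, Finset.sum_const_zero] at h0
  refine squeeze_zero (fun _ => norm_nonneg _) (fun u => ?_) h0
  have := ftrlIter_lipschitz hK hconv hlam hz₁ (c u) (c u₀) m
  rw [inv_mul_eq_div, le_div_iff₀ (by positivity)]
  linarith

lemma pFTRL_take_ofFn {T : ℕ} (msg : Fin T → Message k) {m : ℕ} (hm : m ≤ T) :
    pFTRL K (strongRate lam) z₁ ((List.ofFn msg).take m) =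
      ftrlIter K lam z₁ (fun j => if h : j < T then (msg ⟨j, h⟩).1 else 0) m := by
  have : (((List.ofFn msg).take m).foldl (fun S m => S.update K (strongRate lam) m.1)
      (FTRLState.init z₁)) =
      ftrlState K lam z₁ (fun j => if h : j < T then (msg ⟨j, h⟩).1 else 0) m := by
    induction m with
    | zero => rfl
    | succ m ih =>
      rw [List.take_succ_eq_append_getElem (by simpa using hm), List.foldl_append,
        ih (by omega), ftrlState]
      simp [show m < T from hm]
  rw [pFTRL, this, ftrlIter]

end FTRL

/-! ### Observation order and its relation to delays. -/

namespace LatencyModel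

variable {T : ℕ} (τ : LatencyModel T)

/-- The permutation listing the rounds by increasing feedback time. -/
noncomputable def obsPerm : Equiv.Perm (Fin T) := Tuple.sort τ.r

/-- The number of observations made before the observation of round `s`. -/
noncomputable def rank (s : Fin T) : ℕ := τ.obsPerm.symm s

/-- The number of observations made before the prediction of round `t`. -/
noncomputable def seen (t : Fin T) : ℕ := (Finset.univ.filter fun s => τ.r s < τ.l t).card

lemma strictMono_r_obsPerm : StrictMono (τ.r ∘ τ.obsPerm) :=
  (Tuple.monotone_sort τ.r).strictMono_of_injective (τ.r_injective.comp τ.obsPerm.injective)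

lemma rank_lt (s : Fin T) : τ.rank s < T := (τ.obsPerm.symm s).2

lemma rank_obsPerm (j : Fin T) : τ.rank (τ.obsPerm j) = j := by simp [rank]

lemma obsPerm_rank (s : Fin T) : τ.obsPerm ⟨τ.rank s, τ.rank_lt s⟩ = s := by simp [rank]

lemma lt_rank_iff (j s : Fin T) : (j : ℕ) < τ.rank s ↔ τ.r (τ.obsPerm j) < τ.r s := by
  conv_rhs => rw [← τ.obsPerm_rank s]
  exact (τ.strictMono_r_obsPerm.lt_iff_lt (a := j) (b := ⟨τ.rank s, τ.rank_lt s⟩)).symm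

lemma rank_lt_rank_iff (s t : Fin T) : τ.rank s < τ.rank t ↔ τ.r s < τ.r t := by
  have := τ.lt_rank_iff (τ.obsPerm.symm s) t
  simpa [rank] using this

lemma card_filter_comp_obsPerm (p : Fin T → Prop) [DecidablePred p] :
    (Finset.univ.filter fun j => p (τ.obsPerm j)).card = (Finset.univ.filter p).card := by
  refine Finset.card_bij (fun j _ => τ.obsPerm j) (by simp) (by simp) fun s hs => ?_
  exact ⟨τ.obsPerm.symm s, by simpa using hs, by simp⟩

lemma lt_card_r_lt_iff (j : Fin T) (a : ℝ) :
    (j : ℕ) < (Finset.univ.filter fun s => τ.r s < a).card ↔ τ.r (τ.obsPerm j) < a := by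
  rw [← τ.card_filter_comp_obsPerm]
  exact Tuple.lt_card_lt_iff_apply_lt_of_monotone τ.strictMono_r_obsPerm.monotone

lemma lt_seen_iff (j t : Fin T) : (j : ℕ) < τ.seen t ↔ τ.r (τ.obsPerm j) < τ.l t :=
  τ.lt_card_r_lt_iff j _

lemma seen_le (t : Fin T) : τ.seen t ≤ T := by
  simpa using! Finset.card_le_univ (Finset.univ.filter fun s => τ.r s < τ.l t)

lemma rank_eq_card (s : Fin T) : τ.rank s = (Finset.univ.filter fun s' => τ.r s' < τ.r s).card := by
  have hle : (Finset.univ.filter fun s' => τ.r s' < τ.r s).card ≤ T := by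
    simpa using Finset.card_le_univ (Finset.univ.filter fun s' => τ.r s' < τ.r s)
  have h : ∀ j : Fin T, (j : ℕ) < τ.rank s ↔
      (j : ℕ) < (Finset.univ.filter fun s' => τ.r s' < τ.r s).card := fun j => by
    rw [lt_rank_iff, lt_card_r_lt_iff]
  have h1 := τ.rank_lt s
  rcases lt_trichotomy (τ.rank s) (Finset.univ.filter fun s' => τ.r s' < τ.r s).card with
    h2 | h2 | h2
  · exact absurd ((h ⟨τ.rank s, h1⟩).2 h2) (lt_irrefl _)
  · exact h2
  · exact absurd ((h ⟨_, h2.trans h1⟩).1 h2) (lt_irrefl _)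

/-- Feedback revealed before `r s` comes either before `l s` or inside the latency interval. This
converts a delay into a number of P-FTRL updates. -/
lemma seen_add_dualDelay (s : Fin T) : τ.seen s + τ.dualDelay s = τ.rank s := by
  rw [rank_eq_card, seen, dualDelay, ← Finset.card_union_of_disjoint]
  · congr 1
    ext t
    have h1 := τ.l_lt_r s
    have h2 := τ.l_ne_r s t
    simp only [Finset.mem_union, Finset.mem_filter, Finset.mem_univ, true_and]
    constructor
    · rintro (h | h)
      · linarith
      · exact h.2
    · intro h
      rcases lt_or_gt_of_ne h2 with h3 | h3
      · exact Or.inr ⟨h3, h⟩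
      · exact Or.inl h3
  · rw [Finset.disjoint_filter]
    intro t _ h1 h2
    linarith [h2.1]

/-- The rounds requested before `r s` are those up to `s`, numbering `s + 1` with zero-based
indices, and those inside the latency interval. -/
lemma card_l_lt_r (s : Fin T) :
    (Finset.univ.filter fun t => τ.l t < τ.r s).card = s + τ.delay s + 1 := by
  have : (Finset.univ.filter fun t => τ.l t < τ.r s) =
      Finset.Iic s ∪ Finset.univ.filter fun t => τ.l s < τ.l t ∧ τ.l t < τ.r s := by
    ext t
    have h1 := τ.l_lt_r s
    simp only [Finset.mem_union, Finset.mem_filter, Finset.mem_univ, true_and, Finset.mem_Iic]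
    constructor
    · intro h
      rcases le_or_gt t s with h2 | h2
      · exact Or.inl h2
      · exact Or.inr ⟨τ.l_strictMono h2, h⟩
    · rintro (h | h)
      · exact (τ.l_strictMono.monotone h).trans_lt h1
      · exact h.2
  rw [this, Finset.card_union_of_disjoint, Fin.card_Iic, delay]
  · omega
  · rw [Finset.disjoint_left]
    intro t h1 h2
    rw [Finset.mem_Iic] at h1
    exact absurd (τ.l_strictMono.lt_iff_lt.1 (Finset.mem_filter.1 h2).2.1) (not_lt.2 h1)

/-- Requests are ordered in time, so the rounds requested before `r s` form an initial segment,
whose length is given by `card_l_lt_r`. -/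
lemma le_add_delay_iff (s t : Fin T) : (t : ℕ) ≤ s + τ.delay s ↔ τ.l t < τ.r s := by
  rw [← Nat.lt_succ_iff, Nat.succ_eq_add_one, ← card_l_lt_r]
  exact Tuple.lt_card_lt_iff_apply_lt_of_monotone τ.l_strictMono.monotone

lemma add_delay_lt (s : Fin T) : s + τ.delay s < T := by
  have := Finset.card_le_univ (Finset.univ.filter fun t => τ.l t < τ.r s)
  rw [card_l_lt_r, Fintype.card_fin] at this
  omega

lemma add_delay_lt_iff (s t : Fin T) : s + τ.delay s < (t : ℕ) ↔ τ.r s < τ.l t := by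
  rw [← not_le, le_add_delay_iff, not_lt, (τ.l_ne_r t s).symm.le_iff_lt]

lemma add_delay_mono {s t : Fin T} (h : τ.r s ≤ τ.r t) :
    (s : ℕ) + τ.delay s ≤ t + τ.delay t := by
  have h1 := (τ.le_add_delay_iff s ⟨s + τ.delay s, τ.add_delay_lt s⟩).1 le_rfl
  exact (τ.le_add_delay_iff t ⟨s + τ.delay s, τ.add_delay_lt s⟩).2 (h1.trans_le h)

/-- Both lists are permutations of all rounds sorted by `r`; as `r` is injective, they coincide. -/
lemma obsOrder_eq_ofFn : τ.obsOrder = List.ofFn τ.obsPerm := by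
  have hperm : τ.obsOrder.Perm (List.ofFn τ.obsPerm) := by
    refine (List.mergeSort_perm _ _).trans ?_
    have := τ.obsPerm.ofFn_comp_perm id
    rw [List.ofFn_id] at this
    exact this.symm
  refine hperm.eq_of_pairwise (le := fun s t => τ.r s ≤ τ.r t)
    (fun a b _ _ h1 h2 => τ.r_injective (le_antisymm h1 h2)) ?_ ?_
  · have := List.pairwise_mergeSort (le := fun s t => decide (τ.r s ≤ τ.r t))
      (by simpa using fun a b c => le_trans) (by simpa using fun a b => le_total _ _)
      (List.finRange T)
    simpa using! this
  · rw [List.pairwise_ofFn]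
    exact fun i j hij => (τ.strictMono_r_obsPerm hij).le

lemma pairwise_obsOrder : τ.obsOrder.Pairwise fun s t => τ.r s ≤ τ.r t := by
  rw [obsOrder_eq_ofFn, List.pairwise_ofFn]
  exact fun i j hij => (τ.strictMono_r_obsPerm hij).le

end LatencyModel

/-! ### The message list of the wrapper in closed form. -/

lemma filter_le_of_pairwise {α : Type*} {key : α → ℕ} {L : List α}
    (h : L.Pairwise fun a b => key a ≤ key b) (n : ℕ) :
    L.filter (fun a => decide (key a ≤ n)) =
      L.filter (fun a => decide (key a < n)) ++ L.filter (fun a => decide (key a = n)) := by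
  induction L with
  | nil => rfl
  | cons a L ih =>
    rw [List.pairwise_cons] at h
    have ih := ih h.2
    rcases lt_trichotomy (key a) n with h1 | h1 | h1
    · simp [h1, h1.ne, h1.le, ih]
    · have h2 : L.filter (fun a => decide (key a < n)) = [] := by
        rw [List.filter_eq_nil_iff]
        intro b hb
        have := h.1 b hb
        simp; omega
      rw [h2, List.nil_append] at ih
      simp [h1, h2, ih]
    · simp [h1.ne', show ¬ key a ≤ n by omega, show ¬ key a < n by omega, ih]

lemma filter_eq_take_countP {α : Type*} {p : α → Bool} {L : List α}
    (h : L.Pairwise fun a b => p b → p a) : L.filter p = L.take (L.countP p) := by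
  induction L with
  | nil => rfl
  | cons a L ih =>
    rw [List.pairwise_cons] at h
    by_cases ha : p a
    · simp [ha, ih h.2]
    · have h2 : ∀ b ∈ L, ¬ p b := fun b hb hpb => ha (h.1 b hb hpb)
      have h3 : L.filter p = [] := by rwa [List.filter_eq_nil_iff]
      have h4 : L.countP p = 0 := by rwa [List.countP_eq_zero]
      simp [ha, h3, h4]

lemma LatencyModel.filter_obsOrder {T : ℕ} (τ : LatencyModel T) (t : Fin T) :
    τ.obsOrder.filter (fun s : Fin T => decide ((s : ℕ) + τ.delay s < (t : ℕ))) =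
      τ.obsOrder.take (τ.seen t) := by
  rw [filter_eq_take_countP]
  · congr 1
    have hperm : τ.obsOrder.Perm (List.finRange T) := List.mergeSort_perm _ _
    rw [hperm.countP_eq, List.countP_eq_length_filter, seen]
    simp only [add_delay_lt_iff]
    rfl
  · refine τ.pairwise_obsOrder.imp fun {a b} hab => ?_
    have := τ.add_delay_mono hab
    simp only [decide_eq_true_eq]
    omega

section Unrolling

variable {k T : ℕ} (B : BaseAlgorithm k) (r : ℝ) (δ : ℕ → ℝ) (τ : LatencyModel T)
  (f : Fin T → Vec k → ℝ) (u : Fin T → UnitSphere k)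

lemma wrapperState_succ {n : ℕ} (hn : n < T) : wrapperState B r δ τ f u (n + 1) =
    wrapperRound B r δ τ f u ⟨n, hn⟩ (wrapperState B r δ τ f u n) := by
  simp [wrapperState, hn]

lemma pred_wrapperState (t : Fin T) {n : ℕ} (h1 : (t : ℕ) < n) (h2 : n ≤ T) :
    (wrapperState B r δ τ f u n).pred t =
      (1 - δ ((t : ℕ) + 1) / r) • B (wrapperState B r δ τ f u t).msgs +
        δ ((t : ℕ) + 1) • (u t : Vec k) := by
  induction n, h1 using Nat.le_induction with
  | base =>
    rw [wrapperState_succ B r δ τ f u t.2]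
    simp [wrapperRound]
  | succ n hn ih =>
    rw [wrapperState_succ B r δ τ f u h2, ← ih (by omega)]
    have : t ≠ ⟨n, h2⟩ := by
      intro h
      rw [h] at hn
      simp at hn
    simp [wrapperRound, Function.update_of_ne this]

lemma prediction_eq (t : Fin T) : prediction B r δ τ f u t =
      (1 - δ ((t : ℕ) + 1) / r) • B (wrapperState B r δ τ f u t).msgs +
        δ ((t : ℕ) + 1) • (u t : Vec k) :=
  pred_wrapperState B r δ τ f u t t.2 le_rfl

/-- The message sent to the base algorithm when the feedback of round `s` arrives. -/
noncomputable def message (s : Fin T) : Message k :=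
  (((k : ℝ) / δ ((s : ℕ) + 1) * f s (prediction B r δ τ f u s)) • (u s : Vec k),
    τ.dualDelay s, τ.dualBacklog s)

/-- The arrival round `s + d_s` is nondecreasing in `r s`, so concatenating the batches of
successive rounds never breaks the observation order. -/
lemma msgs_wrapperState {n : ℕ} (hn : n ≤ T) : (wrapperState B r δ τ f u n).msgs =
    (τ.obsOrder.filter (fun s : Fin T => decide ((s : ℕ) + τ.delay s < n))).map
      (message B r δ τ f u) := by
  induction n with
  | zero => simp [wrapperState]
  | succ n ih =>
    simp only [Nat.lt_add_one_iff]
    rw [filter_le_of_pairwise (key := fun s : Fin T => (s : ℕ) + τ.delay s)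
      (τ.pairwise_obsOrder.imp fun {a b} h => τ.add_delay_mono h), List.map_append,
      ← ih (by omega)]
    have h0 : (wrapperState B r δ τ f u (n + 1)).msgs = (wrapperState B r δ τ f u n).msgs ++
        (τ.arrivals ⟨n, hn⟩).map fun s : Fin T =>
          ((((k : ℝ) / δ ((s : ℕ) + 1) * f s ((wrapperState B r δ τ f u (n + 1)).pred s)) •
            (u s : Vec k), τ.dualDelay s, τ.dualBacklog s) : Message k) := by
      rw [wrapperState_succ B r δ τ f u hn]
      rfl
    rw [h0, LatencyModel.arrivals]
    congr 1
    -- A round arriving now satisfies `s ≤ n`, so its stored prediction is already final.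
    refine List.map_congr_left fun s hs => ?_
    have hs := (List.mem_filter.1 hs).2
    simp only [decide_eq_true_eq] at hs
    rw [message, prediction_eq, pred_wrapperState B r δ τ f u s (by omega) hn]

lemma prediction_eq_take (t : Fin T) : prediction B r δ τ f u t =
      (1 - δ ((t : ℕ) + 1) / r) •
        B ((List.ofFn fun j => message B r δ τ f u (τ.obsPerm j)).take (τ.seen t)) +
        δ ((t : ℕ) + 1) • (u t : Vec k) := by
  rw [prediction_eq, msgs_wrapperState _ _ _ _ _ _ t.2.le, τ.filter_obsOrder, List.map_take,
    τ.obsOrder_eq_ofFn, List.map_ofFn]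
  rfl

end Unrolling

/-! ### Weighted sums of dual delays. -/

namespace LatencyModel

variable {T : ℕ} (τ : LatencyModel T)

lemma dualDelay_le_rank (s : Fin T) : τ.dualDelay s ≤ τ.rank s := by
  have := τ.seen_add_dualDelay s
  omega

lemma dualBacklog_le_maxBacklog (s : Fin T) : τ.dualBacklog s ≤ τ.maxBacklog := by
  -- `t` is the last round requested before `r s`. Everything pending at `r s`, except possibly `t`
  -- itself, is pending at `l t`; if `t ≠ s`, the backlog at `l t` also contains `s`, which makes up
  -- for `t`.
  set t : Fin T := ⟨s + τ.delay s, τ.add_delay_lt s⟩ with ht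
  have hlt : τ.l t < τ.r s := (τ.le_add_delay_iff s t).1 le_rfl
  have hmax : ∀ t', τ.l t' < τ.r s → t' ≤ t := fun t' h => (τ.le_add_delay_iff s t').2 h
  have hst : s ≤ t := hmax s (τ.l_lt_r s)
  refine le_trans ?_ (Finset.le_sup (Finset.mem_univ t))
  rcases hst.eq_or_lt with h | h
  · refine Finset.card_le_card fun s' hs' => ?_
    simp only [Finset.mem_filter, Finset.mem_univ, true_and] at hs' ⊢
    have h1 := hmax s' hs'.1
    have h2 : s' ≠ t := by
      rintro rfl
      rw [h] at hs'
      exact lt_irrefl _ hs'.2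
    exact ⟨τ.l_strictMono (lt_of_le_of_ne h1 h2), hlt.trans hs'.2⟩
  · have hs : s ∈ Finset.univ.filter fun s' => τ.l s' < τ.l t ∧ τ.l t < τ.r s' := by
      simp only [Finset.mem_filter, Finset.mem_univ, true_and]
      exact ⟨τ.l_strictMono h, hlt⟩
    calc τ.dualBacklog s ≤ (insert t ((Finset.univ.filter fun s' =>
          τ.l s' < τ.l t ∧ τ.l t < τ.r s').erase s)).card := by
          refine Finset.card_le_card fun s' hs' => ?_
          simp only [Finset.mem_filter, Finset.mem_univ, true_and, Finset.mem_insert,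
            Finset.mem_erase] at hs' ⊢
          have h1 := hmax s' hs'.1
          rcases h1.eq_or_lt with h2 | h2
          · exact Or.inl h2
          · refine Or.inr ⟨?_, τ.l_strictMono h2, hlt.trans hs'.2⟩
            rintro rfl
            exact lt_irrefl _ hs'.2
      _ ≤ _ := Finset.card_insert_le _ _
      _ = τ.backlog t := Finset.card_erase_add_one hs

/-- Double counting. For two distinct rounds, exactly one endpoint of each kind, request or
feedback, lies in the other interval when the intervals overlap, and none does when they are
disjoint. -/
lemma sum_dualDelay : ∑ t, τ.dualDelay t = τ.totalDelay := by
  simp only [totalDelay, dualDelay, delay, Finset.card_filter]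
  have key : ∀ s t : Fin T,
      ((if τ.l t < τ.r s ∧ τ.r s < τ.r t then 1 else 0) +
        (if τ.l s < τ.r t ∧ τ.r t < τ.r s then 1 else 0) : ℕ) =
      (if τ.l t < τ.l s ∧ τ.l s < τ.r t then 1 else 0) +
        (if τ.l s < τ.l t ∧ τ.l t < τ.r s then 1 else 0) := by
    intro s t
    rcases eq_or_ne s t with rfl | hne
    · simp
    have h1 := τ.l_lt_r s
    have h2 := τ.l_lt_r t
    have h3 : τ.r s ≠ τ.r t := τ.r_injective.ne hne
    have h4 : τ.l s ≠ τ.l t := τ.l_strictMono.injective.ne hne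
    have h5 := τ.l_ne_r s t
    have h6 := τ.l_ne_r t s
    grind
  have h := Finset.sum_congr (rfl : (Finset.univ : Finset (Fin T)) = Finset.univ)
    fun t _ => Finset.sum_congr (rfl : (Finset.univ : Finset (Fin T)) = Finset.univ)
      fun s _ => key s t
  simp only [Finset.sum_add_distrib] at h
  rw [Finset.sum_comm (f := fun t s => if τ.l s < τ.r t ∧ τ.r t < τ.r s then 1 else 0),
    Finset.sum_comm (f := fun t s => if τ.l s < τ.l t ∧ τ.l t < τ.r s then 1 else 0)] at h
  omega

lemma sum_comp_rank (F : ℕ → ℝ) : ∑ s, F (τ.rank s) = ∑ j ∈ Finset.range T, F j := by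
  rw [Finset.sum_range, ← Equiv.sum_comp τ.obsPerm]
  simp [rank_obsPerm]

/-- A feedback `t` inside the interval of `s` has smaller rank, so the weight may be moved from `s`
to `t`. Exchanging the sums then counts dual backlogs instead of dual delays. -/
lemma sum_dualDelay_div_le_maxBacklog :
    ∑ s, (τ.dualDelay s : ℝ) / (τ.rank s + 1) ≤
      τ.maxBacklog * ∑ j ∈ Finset.range T, 1 / ((j : ℝ) + 1) := by
  calc ∑ s, (τ.dualDelay s : ℝ) / (τ.rank s + 1)
      = ∑ s, ∑ t, (if τ.l s < τ.r t ∧ τ.r t < τ.r s then 1 / ((τ.rank s : ℝ) + 1) else 0) := by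
        refine Finset.sum_congr rfl fun s _ => ?_
        rw [← Finset.sum_filter, Finset.sum_const, dualDelay, nsmul_eq_mul]
        ring
    _ ≤ ∑ s, ∑ t, (if τ.l s < τ.r t ∧ τ.r t < τ.r s then 1 / ((τ.rank t : ℝ) + 1) else 0) := by
        refine Finset.sum_le_sum fun s _ => Finset.sum_le_sum fun t _ => ?_
        split_ifs with h
        · have : (τ.rank t : ℝ) ≤ τ.rank s := by
            exact_mod_cast ((τ.rank_lt_rank_iff t s).2 h.2).le
          exact one_div_le_one_div_of_le (by positivity) (by linarith)
        · exact le_rfl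
    _ = ∑ t, (τ.dualBacklog t : ℝ) * (1 / ((τ.rank t : ℝ) + 1)) := by
        rw [Finset.sum_comm]
        refine Finset.sum_congr rfl fun t _ => ?_
        rw [← Finset.sum_filter, Finset.sum_const, dualBacklog, nsmul_eq_mul]
    _ ≤ ∑ t, (τ.maxBacklog : ℝ) * (1 / ((τ.rank t : ℝ) + 1)) := by
        refine Finset.sum_le_sum fun t _ => mul_le_mul_of_nonneg_right ?_ (by positivity)
        exact_mod_cast τ.dualBacklog_le_maxBacklog t
    _ = _ := by
        rw [← Finset.mul_sum, τ.sum_comp_rank fun j => 1 / ((j : ℝ) + 1)]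

/-- With `X = √d_tot`, each term is at most `1`, and at most `X` ranks satisfy `rank + 1 ≤ X`. For
the others the denominator exceeds `X`, and they add up to at most `d_tot / X = X`. -/
lemma sum_dualDelay_div_le_sqrt :
    ∑ s, (τ.dualDelay s : ℝ) / (τ.rank s + 1) ≤ 2 * √(τ.totalDelay : ℝ) := by
  rcases Nat.eq_zero_or_pos τ.totalDelay with h0 | h0
  · have h1 := τ.sum_dualDelay
    rw [h0, Finset.sum_eq_zero_iff] at h1
    rw [h0, Finset.sum_eq_zero fun s hs => by rw [h1 s hs]; simp]
    simp
  set X := √(τ.totalDelay : ℝ) with hX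
  have hXpos : 0 < X := Real.sqrt_pos.2 (by exact_mod_cast h0)
  have hterm : ∀ s, (τ.dualDelay s : ℝ) / (τ.rank s + 1) ≤
      (if (τ.rank s : ℝ) + 1 ≤ X then 1 else 0) + τ.dualDelay s / X := by
    intro s
    have h1 : (τ.dualDelay s : ℝ) ≤ τ.rank s := by exact_mod_cast τ.dualDelay_le_rank s
    split_ifs with h
    · have : (τ.dualDelay s : ℝ) / (τ.rank s + 1) ≤ 1 := by
        rw [div_le_one (by positivity)]; linarith
      have : 0 ≤ (τ.dualDelay s : ℝ) / X := by positivity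
      linarith
    · rw [zero_add]
      exact div_le_div_of_nonneg_left (by positivity) hXpos (not_le.1 h).le
  have hcount : ∑ s, (if (τ.rank s : ℝ) + 1 ≤ X then (1 : ℝ) else 0) ≤ X := by
    rw [τ.sum_comp_rank fun j => if (j : ℝ) + 1 ≤ X then (1 : ℝ) else 0, Finset.sum_boole]
    calc _ ≤ (((Finset.range ⌊X⌋₊).card : ℕ) : ℝ) := by
          refine Nat.cast_le.2 (Finset.card_le_card fun j hj => ?_)
          rw [Finset.mem_filter] at hj
          rw [Finset.mem_range, ← Nat.succ_le_iff]
          exact Nat.le_floor (by push_cast; exact hj.2)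
      _ ≤ X := by
          rw [Finset.card_range]
          exact Nat.floor_le hXpos.le
  calc _ ≤ ∑ s, ((if (τ.rank s : ℝ) + 1 ≤ X then 1 else 0) + τ.dualDelay s / X) :=
        Finset.sum_le_sum fun s _ => hterm s
    _ ≤ X + X := by
        rw [Finset.sum_add_distrib, ← Finset.sum_div]
        refine add_le_add hcount (le_of_eq ?_)
        rw [← Nat.cast_sum, sum_dualDelay, div_eq_iff hXpos.ne', hX,
          Real.mul_self_sqrt (Nat.cast_nonneg _)]
    _ = _ := by ring

lemma sum_one_div_le_log (hT : 2 ≤ T) :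
    ∑ j ∈ Finset.range T, 1 / ((j : ℝ) + 1) ≤ 3 * Real.log T := by
  have h1 := harmonic_le_one_add_log T
  have h2 : ((harmonic T : ℚ) : ℝ) = ∑ j ∈ Finset.range T, 1 / ((j : ℝ) + 1) := by
    simp [harmonic]
  have h3 : Real.log 2 ≤ Real.log T := Real.log_le_log (by norm_num) (by exact_mod_cast hT)
  -- The constant term of the harmonic bound is absorbed through `1 ≤ 2 log 2`.
  have := Real.log_two_gt_d9
  rw [h2] at h1
  linarith

lemma sum_dualDelay_div_le (hT : 2 ≤ T) :
    ∑ s, (τ.dualDelay s : ℝ) / (τ.rank s + 1) ≤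
      3 * min (τ.maxBacklog * Real.log T) (√(τ.totalDelay : ℝ)) := by
  rw [mul_min_of_nonneg _ _ (by norm_num), le_min_iff]
  constructor
  · refine τ.sum_dualDelay_div_le_maxBacklog.trans ?_
    have := mul_le_mul_of_nonneg_left (sum_one_div_le_log hT)
      (Nat.cast_nonneg (α := ℝ) τ.maxBacklog)
    linarith
  · refine τ.sum_dualDelay_div_le_sqrt.trans ?_
    have := Real.sqrt_nonneg (τ.totalDelay : ℝ)
    linarith

end LatencyModel
-- Predictions as functions of the exploration directions.
/-- A bandit problem with delays together with the parameters of the wrapper around P-FTRL, and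
subgradients of the losses that witness strong convexity. -/
structure Setting (k T : ℕ) where
  K : Set (Vec k)
  r : ℝ
  G : ℝ
  M : ℝ
  lam : ℝ
  z₁ : Vec k
  δ : ℕ → ℝ
  τ : LatencyModel T
  f : Fin T → Vec k → ℝ
  g : Fin T → Vec k → Vec k
  isCompact : IsCompact K
  convex : Convex ℝ K
  r_pos : 0 < r
  ball_subset : Metric.closedBall 0 r ⊆ K
  lam_pos : 0 < lam
  data : ∀ t, SubgradientData K G lam (f t) (g t)
  abs_le : ∀ t, ∀ x ∈ K, |f t x| ≤ M
  z₁_mem : z₁ ∈ K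
  δ_pos : ∀ t : Fin T, 0 < δ (t + 1)
  δ_le : ∀ t : Fin T, δ (t + 1) ≤ r

namespace Setting

variable {k T : ℕ} (S : Setting k T)

/-- The prediction of the wrapper in round `t` as a function of the exploration directions. -/
noncomputable def pred (u : Fin T → UnitSphere k) (t : Fin T) : Vec k :=
  prediction (pFTRL S.K (strongRate S.lam) S.z₁) S.r S.δ S.τ S.f u t

/-- The loss vector sent to P-FTRL for round `s`. -/
noncomputable def lossVec (u : Fin T → UnitSphere k) (s : Fin T) : Vec k :=
  ((k : ℝ) / S.δ (s + 1) * S.f s (S.pred u s)) • (u s : Vec k)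

/-- The loss vectors in the order in which P-FTRL receives them. -/
noncomputable def lossSeq (u : Fin T → UnitSphere k) (j : ℕ) : Vec k :=
  if h : j < T then S.lossVec u (S.τ.obsPerm ⟨j, h⟩) else 0

/-- The prediction of P-FTRL after `m` updates. -/
noncomputable def iter (u : Fin T → UnitSphere k) (m : ℕ) : Vec k :=
  ftrlIter S.K S.lam S.z₁ (S.lossSeq u) m

lemma iter_mem (u : Fin T → UnitSphere k) (m : ℕ) : S.iter u m ∈ S.K :=
  ftrlIter_mem S.isCompact S.z₁_mem m

lemma lossSeq_rank (u : Fin T → UnitSphere k) (s : Fin T) :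
    S.lossSeq u (S.τ.rank s) = S.lossVec u s := by
  rw [lossSeq, dif_pos (S.τ.rank_lt s), S.τ.obsPerm_rank]

lemma pred_eq (u : Fin T → UnitSphere k) (t : Fin T) :
    S.pred u t = (1 - S.δ (t + 1) / S.r) • S.iter u (S.τ.seen t) + S.δ (t + 1) • (u t : Vec k) := by
  rw [pred, prediction_eq_take, pFTRL_take_ofFn _ (S.τ.seen_le t)]
  rfl

lemma ratio_pos (t : Fin T) : 0 < S.δ (t + 1) / S.r := div_pos (S.δ_pos t) S.r_pos

lemma ratio_le_one (t : Fin T) : S.δ (t + 1) / S.r ≤ 1 := (div_le_one S.r_pos).2 (S.δ_le t)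

/-- A point of this ball is the convex combination, with weight `δ/r`, of `z` and a point of the
ball of radius `r` around `0`. -/
lemma closedBall_subset (t : Fin T) {z : Vec k} (hz : z ∈ S.K) :
    Metric.closedBall ((1 - S.δ (t + 1) / S.r) • z) (S.δ (t + 1)) ⊆ S.K := by
  intro p hp
  have hδ := S.δ_pos t
  have hr := S.r_pos
  set w := (1 - S.δ (t + 1) / S.r) • z with hw
  have h1 : (S.r / S.δ (t + 1)) • (p - w) ∈ S.K := by
    apply S.ball_subset
    rw [mem_closedBall_zero_iff, norm_smul, Real.norm_eq_abs, abs_of_pos (by positivity)]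
    rw [Metric.mem_closedBall, dist_eq_norm] at hp
    calc _ ≤ S.r / S.δ (t + 1) * S.δ (t + 1) := mul_le_mul_of_nonneg_left hp (by positivity)
      _ = S.r := by field_simp
  have h2 := S.convex hz h1 (sub_nonneg.2 (S.ratio_le_one t)) (S.ratio_pos t).le (by ring)
  rw [smul_smul, show S.δ (t + 1) / S.r * (S.r / S.δ (t + 1)) = 1 by field_simp, one_smul, ← hw,
    add_sub_cancel] at h2
  exact h2

lemma add_smul_mem_closedBall (t : Fin T) (w : Vec k) (v : UnitSphere k) :
    w + S.δ (t + 1) • (v : Vec k) ∈ Metric.closedBall w (S.δ (t + 1)) := by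
  simp [norm_smul, abs_of_pos (S.δ_pos t)]

lemma pred_mem_closedBall (u : Fin T → UnitSphere k) (t : Fin T) : S.pred u t ∈
    Metric.closedBall ((1 - S.δ (t + 1) / S.r) • S.iter u (S.τ.seen t)) (S.δ (t + 1)) := by
  rw [pred_eq]
  exact S.add_smul_mem_closedBall t _ _

lemma pred_mem (u : Fin T → UnitSphere k) (t : Fin T) : S.pred u t ∈ S.K :=
  S.closedBall_subset t (S.iter_mem u _) (S.pred_mem_closedBall u t)

lemma zero_mem : (0 : Vec k) ∈ S.K := S.ball_subset (by simp [S.r_pos.le])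

lemma G_nonneg (t : Fin T) : 0 ≤ S.G :=
  (norm_nonneg _).trans ((S.data t).norm_le 0 S.zero_mem)

lemma norm_sub_le (t : Fin T) {x y : Vec k} (hx : x ∈ S.K) (hy : y ∈ S.K) :
    ‖x - y‖ ≤ 2 * S.G / S.lam :=
  (S.data t).norm_sub_le S.lam_pos hx hy

section Continuity

lemma continuousOn_loss (t : Fin T) : ContinuousOn (S.f t) S.K := by
  have : LipschitzOnWith ⟨S.G, S.G_nonneg t⟩ (S.f t) S.K :=
    LipschitzOnWith.of_dist_le_mul fun x hx y hy => by
      rw [Real.dist_eq, dist_eq_norm]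
      exact (S.data t).abs_sub_le S.lam_pos.le hx hy
  exact this.continuousOn

/-- Induction on the round: the iterate used in round `t` involves only losses whose feedback, hence
whose request, precedes `l t`. -/
lemma continuous_pred (t : Fin T) : Continuous fun u => S.pred u t := by
  induction t using WellFoundedLT.induction with
  | ind t ih =>
  simp only [pred_eq]
  have h1 : Continuous fun u => S.iter u (S.τ.seen t) := by
    refine continuous_ftrlIter S.isCompact S.convex S.lam_pos S.z₁_mem _ fun j hj => ?_
    have hjT : j < T := hj.trans_le (S.τ.seen_le t)
    simp only [lossSeq, dif_pos hjT, lossVec]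
    have h2 := (S.τ.lt_seen_iff ⟨j, hjT⟩ t).1 hj
    have h3 := ih (S.τ.obsPerm ⟨j, hjT⟩)
      (S.τ.l_strictMono.lt_iff_lt.1 ((S.τ.l_lt_r _).trans h2))
    have h4 : Continuous fun u => S.f (S.τ.obsPerm ⟨j, hjT⟩) (S.pred u (S.τ.obsPerm ⟨j, hjT⟩)) :=
      (S.continuousOn_loss _).comp_continuous h3 fun u => S.pred_mem u _
    fun_prop
  fun_prop

lemma continuous_loss_pred (t : Fin T) : Continuous fun u => S.f t (S.pred u t) :=
  (S.continuousOn_loss t).comp_continuous (S.continuous_pred t) fun u => S.pred_mem u t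

lemma continuous_lossVec (s : Fin T) : Continuous fun u => S.lossVec u s := by
  unfold lossVec
  have := S.continuous_loss_pred s
  fun_prop

lemma continuous_lossSeq (j : ℕ) : Continuous fun u => S.lossSeq u j := by
  unfold lossSeq
  split_ifs
  · exact S.continuous_lossVec _
  · exact continuous_const

lemma continuous_iter (m : ℕ) : Continuous fun u => S.iter u m :=
  continuous_ftrlIter S.isCompact S.convex S.lam_pos S.z₁_mem _ fun j _ => S.continuous_lossSeq j

end Continuity

section Dependence

/-- A prediction requested before `r s` uses only feedback revealed earlier, which excludes that of
`s`; the rounds behind this feedback are requested earlier still, so induction applies. -/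
lemma pred_update (u : Fin T → UnitSphere k) {s t : Fin T} (hts : t ≠ s) (h : S.τ.l t < S.τ.r s)
    (v : UnitSphere k) : S.pred (Function.update u s v) t = S.pred u t := by
  induction t using WellFoundedLT.induction with
  | ind t ih =>
  rw [pred_eq, pred_eq, Function.update_of_ne hts]
  congr 2
  refine ftrlIter_congr fun j hj => ?_
  have hjT : j < T := hj.trans_le (S.τ.seen_le t)
  simp only [lossSeq, dif_pos hjT, lossVec]
  have h2 := (S.τ.lt_seen_iff ⟨j, hjT⟩ t).1 hj
  have h3 : S.τ.obsPerm ⟨j, hjT⟩ ≠ s := by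
    intro h3
    rw [h3] at h2
    exact lt_asymm h h2
  have h4 := S.τ.l_lt_r (S.τ.obsPerm ⟨j, hjT⟩)
  rw [Function.update_of_ne h3, ih _ (S.τ.l_strictMono.lt_iff_lt.1 (h4.trans h2)) h3
    (h4.trans (h2.trans h))]

/-- The bound `rank s` is inclusive: that iterate is computed just before the loss vector of `s` is
processed. This independence of `u s` is what makes `rank s` the right comparison index. -/
lemma iter_update (u : Fin T → UnitSphere k) {s : Fin T} {m : ℕ} (hm : m ≤ S.τ.rank s)
    (v : UnitSphere k) : S.iter (Function.update u s v) m = S.iter u m := by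
  refine ftrlIter_congr fun j hj => ?_
  have hjs := hj.trans_le hm
  have hjT : j < T := hjs.trans (S.τ.rank_lt s)
  simp only [lossSeq, dif_pos hjT, lossVec]
  have h2 := (S.τ.lt_rank_iff ⟨j, hjT⟩ s).1 hjs
  have h3 : S.τ.obsPerm ⟨j, hjT⟩ ≠ s := by
    intro h3
    rw [h3] at h2
    exact lt_irrefl _ h2
  rw [Function.update_of_ne h3, S.pred_update u h3 ((S.τ.l_lt_r _).trans h2)]

lemma seen_le_rank (s : Fin T) : S.τ.seen s ≤ S.τ.rank s := by
  have := S.τ.seen_add_dualDelay s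
  omega

lemma lossVec_update_self (u : Fin T → UnitSphere k) (s : Fin T) (v : UnitSphere k) :
    S.lossVec (Function.update u s v) s = ((k : ℝ) / S.δ (s + 1) *
      S.f s ((1 - S.δ (s + 1) / S.r) • S.iter u (S.τ.seen s) + S.δ (s + 1) • (v : Vec k))) •
        (v : Vec k) := by
  rw [lossVec, pred_eq, S.iter_update u (S.seen_le_rank s), Function.update_self]

lemma lossVec_update_of_lt (u : Fin T → UnitSphere k) {i j : Fin T} (hij : i < j)
    (v : UnitSphere k) : S.lossVec (Function.update u j v) i = S.lossVec u i := by
  rw [lossVec, S.pred_update u hij.ne ((S.τ.l_strictMono hij).trans (S.τ.l_lt_r j)),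
    Function.update_of_ne hij.ne, lossVec]

end Dependence

end Setting

/-! ### Resampling one coordinate of a product measure. -/

section Resampling

variable {ι X : Type*} [DecidableEq ι] [MeasurableSpace X]

lemma measurable_update_prod (s : ι) :
    Measurable fun p : (ι → X) × X => Function.update p.1 s p.2 := by
  rw [measurable_pi_iff]
  intro i
  by_cases h : i = s
  · subst h
    simpa using measurable_snd
  · simp only [Function.update_of_ne h]
    exact (measurable_pi_apply i).comp measurable_fst

lemma map_update_pi [Fintype ι] (μ : Measure X) [IsProbabilityMeasure μ] (s : ι) :
    ((Measure.pi fun _ : ι => μ).prod μ).map (fun p => Function.update p.1 s p.2) =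
      Measure.pi fun _ : ι => μ := by
  symm
  refine Measure.pi_eq fun A hA => ?_
  rw [Measure.map_apply (measurable_update_prod s) (MeasurableSet.univ_pi hA)]
  have : (fun p : (ι → X) × X => Function.update p.1 s p.2) ⁻¹' Set.univ.pi A =
      (Set.univ.pi (Function.update A s Set.univ)) ×ˢ A s := by
    ext p
    simp only [Set.mem_preimage, Set.mem_pi, Set.mem_univ, true_implies, Set.mem_prod]
    constructor
    · intro h
      refine ⟨fun i => ?_, by simpa using h s⟩
      by_cases hi : i = s
      · subst hi; simp
      · simpa [Function.update_of_ne hi] using h i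
    · rintro ⟨h1, h2⟩ i
      by_cases hi : i = s
      · subst hi; simpa using h2
      · simpa [Function.update_of_ne hi] using h1 i
  rw [this, Measure.prod_prod, Measure.pi_pi,
    ← Finset.mul_prod_erase Finset.univ (fun i => μ (A i)) (Finset.mem_univ s),
    ← Finset.mul_prod_erase Finset.univ _ (Finset.mem_univ s)]
  rw [Function.update_self, measure_univ, one_mul, mul_comm]
  congr 1
  refine Finset.prod_congr rfl fun i hi => ?_
  rw [Function.update_of_ne (Finset.ne_of_mem_erase hi)]

/-- Resampling one coordinate of an i.i.d. family does not change expectations. -/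
lemma integral_pi_update [Fintype ι] (μ : Measure X) [IsProbabilityMeasure μ] (s : ι)
    {F : (ι → X) → ℝ}
    (hF : Integrable F (Measure.pi fun _ : ι => μ)) :
    ∫ u, F u ∂(Measure.pi fun _ : ι => μ) =
      ∫ u, ∫ v, F (Function.update u s v) ∂μ ∂(Measure.pi fun _ : ι => μ) := by
  rw [← map_update_pi μ s] at hF
  conv_lhs => rw [← map_update_pi μ s]
  rw [integral_map (measurable_update_prod s).aemeasurable hF.aestronglyMeasurable]
  exact integral_prod _ (hF.comp_measurable (measurable_update_prod s))

end Resampling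

/-! ### Conditional means, orthogonal noise and expected drift. -/

namespace Setting

variable {k T : ℕ} (S : Setting k T)

/-- The joint law of the exploration directions. -/
noncomputable abbrev dirLaw (k T : ℕ) : Measure (Fin T → UnitSphere k) :=
  Measure.pi fun _ : Fin T => unifSphere k

/-- The conditional mean of the loss vector of round `s` given the other directions. -/
noncomputable def mean (u : Fin T → UnitSphere k) (s : Fin T) : Vec k :=
  ∫ v, S.lossVec (Function.update u s v) s ∂unifSphere k

/-- The centered loss vector of round `s`. -/
noncomputable def noise (u : Fin T → UnitSphere k) (s : Fin T) : Vec k :=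
  S.lossVec u s - S.mean u s

lemma mean_update_of_lt (u : Fin T → UnitSphere k) {i j : Fin T} (hij : i < j) (v : UnitSphere k) :
    S.mean (Function.update u j v) i = S.mean u i := by
  unfold mean
  congr 1 with w
  rw [Function.update_comm hij.ne', S.lossVec_update_of_lt _ hij]

lemma noise_update_of_lt (u : Fin T → UnitSphere k) {i j : Fin T} (hij : i < j)
    (v : UnitSphere k) : S.noise (Function.update u j v) i = S.noise u i := by
  rw [noise, S.lossVec_update_of_lt u hij, S.mean_update_of_lt u hij, noise]

lemma mean_eq (u : Fin T → UnitSphere k) (s : Fin T) :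
    S.mean u s = ∫ v : UnitSphere k, ((k : ℝ) / S.δ (s + 1) *
      S.f s ((1 - S.δ (s + 1) / S.r) • S.iter u (S.τ.seen s) + S.δ (s + 1) • (v : Vec k))) •
        (v : Vec k) ∂unifSphere k := by
  simp only [mean, lossVec_update_self]

lemma continuous_mean [NeZero k] (s : Fin T) : Continuous fun u => S.mean u s := by
  have h : Continuous (Function.uncurry fun (u : Fin T → UnitSphere k) (v : UnitSphere k) =>
      S.lossVec (Function.update u s v) s) := by
    apply (S.continuous_lossVec s).comp
    exact continuous_fst.update s continuous_snd
  have := continuous_parametric_integral_of_continuous (μ := unifSphere k) h isCompact_univ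
  simpa [mean] using this

lemma continuous_noise [NeZero k] (s : Fin T) : Continuous fun u => S.noise u s :=
  (S.continuous_lossVec s).sub (S.continuous_mean s)

lemma continuous_loss_smoothing (u : Fin T → UnitSphere k) (s : Fin T) :
    Continuous fun v : UnitSphere k =>
      S.f s ((1 - S.δ (s + 1) / S.r) • S.iter u (S.τ.seen s) + S.δ (s + 1) • (v : Vec k)) :=
  (S.continuousOn_loss s).comp_continuous (by fun_prop) fun v =>
    S.closedBall_subset s (S.iter_mem u _) (S.add_smul_mem_closedBall s _ v)

lemma norm_mean_le [NeZero k] (u : Fin T → UnitSphere k) (s : Fin T) : ‖S.mean u s‖ ≤ S.G := by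
  rw [mean_eq]
  exact (S.data s).norm_onePoint_le S.lam_pos.le (S.δ_pos s)
    (S.closedBall_subset s (S.iter_mem u _)) (S.continuous_loss_smoothing u s)

lemma norm_lossVec_le (u : Fin T → UnitSphere k) (s : Fin T) :
    ‖S.lossVec u s‖ ≤ k * S.M / S.δ (s + 1) := by
  have h := S.δ_pos s
  rw [lossVec, norm_smul, norm_coe_unitSphere, mul_one, norm_mul, Real.norm_eq_abs,
    Real.norm_eq_abs, abs_of_nonneg (by positivity)]
  calc _ ≤ (k : ℝ) / S.δ (s + 1) * S.M :=
        mul_le_mul_of_nonneg_left (S.abs_le s _ (S.pred_mem u s)) (by positivity)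
    _ = _ := by ring

lemma norm_noise_le [NeZero k] {V : ℝ} (hV : ∀ s : Fin T, k * S.M / S.δ (s + 1) ≤ V)
    (u : Fin T → UnitSphere k) (s : Fin T) : ‖S.noise u s‖ ≤ 2 * V := by
  have h1 : ∀ u, ‖S.lossVec u s‖ ≤ V := fun u => (S.norm_lossVec_le u s).trans (hV s)
  have h2 : ‖S.mean u s‖ ≤ V := by
    have := norm_integral_le_of_norm_le_const (μ := unifSphere k)
      (f := fun v => S.lossVec (Function.update u s v) s)
      (Filter.Eventually.of_forall fun v => h1 _)
    simpa [mean] using this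
  calc _ ≤ ‖S.lossVec u s‖ + ‖S.mean u s‖ := _root_.norm_sub_le _ _
    _ ≤ _ := by linarith [h1 u]

/-- The tower property in Fubini form: only the coordinate `s` is resampled, and `Y` ignores it. -/
lemma integral_inner_lossVec [NeZero k] {Y : (Fin T → UnitSphere k) → Vec k} (hY : Continuous Y)
    {s : Fin T}
    (hYs : ∀ u v, Y (Function.update u s v) = Y u) :
    ∫ u, inner ℝ (S.lossVec u s) (Y u) ∂dirLaw k T =
      ∫ u, inner ℝ (S.mean u s) (Y u) ∂dirLaw k T := by
  have h1 := S.continuous_lossVec s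
  rw [integral_pi_update (unifSphere k) s (integrable_of_continuous_of_compact (by fun_prop))]
  congr 1 with u
  simp only [hYs]
  rw [mean, real_inner_comm, ← integral_inner]
  · simp only [real_inner_comm]
  · exact integrable_of_continuous_of_compact
      (h1.comp (continuous_const.update s continuous_id))

lemma integral_inner_noise [NeZero k] {Y : (Fin T → UnitSphere k) → Vec k} (hY : Continuous Y)
    {s : Fin T}
    (hYs : ∀ u v, Y (Function.update u s v) = Y u) :
    ∫ u, inner ℝ (S.noise u s) (Y u) ∂dirLaw k T = 0 := by
  have h1 := S.continuous_lossVec s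
  have h2 := S.continuous_mean s
  simp only [noise, inner_sub_left]
  rw [integral_sub (integrable_of_continuous_of_compact (by fun_prop))
    (integrable_of_continuous_of_compact (by fun_prop)), S.integral_inner_lossVec hY hYs, sub_self]

/-- The noise of the earlier round in request order ignores the direction of the later one, whatever
the order of their feedback. -/
lemma integral_inner_noise_noise [NeZero k] {i j : Fin T} (hij : i ≠ j) :
    ∫ u, inner ℝ (S.noise u i) (S.noise u j) ∂dirLaw k T = 0 := by
  rcases lt_or_gt_of_ne hij with h | h
  · simp only [real_inner_comm (S.noise _ j)]
    exact S.integral_inner_noise (S.continuous_noise i) fun u v => S.noise_update_of_lt u h v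
  · exact S.integral_inner_noise (S.continuous_noise j) fun u v => S.noise_update_of_lt u h v

lemma integral_norm_sum_noise_sq_le [NeZero k] {V : ℝ} (hV : ∀ s : Fin T, k * S.M / S.δ (s + 1) ≤ V)
    (A : Finset (Fin T)) :
    ∫ u, ‖∑ s ∈ A, S.noise u s‖ ^ 2 ∂dirLaw k T ≤ A.card * (2 * V) ^ 2 := by
  have hc := fun s => S.continuous_noise s
  have hint : ∀ i j, Integrable (fun u => inner ℝ (S.noise u i) (S.noise u j)) (dirLaw k T) :=
    fun i j => integrable_of_continuous_of_compact ((hc i).inner (hc j))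
  have h1 : ∫ u, ‖∑ s ∈ A, S.noise u s‖ ^ 2 ∂dirLaw k T =
      ∑ i ∈ A, ∑ j ∈ A, ∫ u, inner ℝ (S.noise u i) (S.noise u j) ∂dirLaw k T := by
    simp only [← real_inner_self_eq_norm_sq, inner_sum, sum_inner]
    rw [Finset.sum_comm]
    rw [integral_finsetSum _ fun i _ => integrable_finsetSum _ fun j _ => hint j i]
    refine Finset.sum_congr rfl fun i _ => ?_
    rw [integral_finsetSum _ fun j _ => hint j i]
  rw [h1]
  calc _ = ∑ i ∈ A, ∫ u, inner ℝ (S.noise u i) (S.noise u i) ∂dirLaw k T := by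
        refine Finset.sum_congr rfl fun i hi => ?_
        rw [Finset.sum_eq_single i (fun j _ hj => S.integral_inner_noise_noise hj.symm)
          (fun h => absurd hi h)]
    _ ≤ ∑ _i ∈ A, (2 * V) ^ 2 := by
        refine Finset.sum_le_sum fun i _ => ?_
        have : ∫ u, inner ℝ (S.noise u i) (S.noise u i) ∂dirLaw k T ≤
            ∫ _u, (2 * V) ^ 2 ∂dirLaw k T := by
          refine integral_mono (hint i i) (integrable_const _) fun u => ?_
          rw [real_inner_self_eq_norm_sq]
          exact pow_le_pow_left₀ (norm_nonneg _) (S.norm_noise_le hV u i) 2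
        simpa using this
    _ = _ := by rw [Finset.sum_const, nsmul_eq_mul]

/-- Sums of few loss vectors are small on average: the means contribute at most `G` each and the
noise adds up like a martingale. -/
lemma integral_norm_sum_lossVec_le [NeZero k] (hG : 0 < S.G) {V : ℝ}
    (hV : ∀ s : Fin T, k * S.M / S.δ (s + 1) ≤ V) {A : Finset (Fin T)} {d : ℕ} (hd : 0 < d)
    (hA : A.card ≤ d) :
    ∫ u, ‖∑ s ∈ A, S.lossVec u s‖ ∂dirLaw k T ≤ 3 / 2 * (d * S.G) + 2 * (V ^ 2 / S.G) := by
  have hd' : (0 : ℝ) < d := by exact_mod_cast hd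
  have hA' : (A.card : ℝ) ≤ d := by exact_mod_cast hA
  have hc1 := fun s => S.continuous_noise s
  have hc2 := fun s => S.continuous_lossVec s
  have hi1 : Integrable (fun u => ‖∑ s ∈ A, S.noise u s‖ ^ 2) (dirLaw k T) :=
    integrable_of_continuous_of_compact (by fun_prop)
  have hpt : ∀ u, ‖∑ s ∈ A, S.lossVec u s‖ ≤
      3 / 2 * (d * S.G) + (2 * (d * S.G))⁻¹ * ‖∑ s ∈ A, S.noise u s‖ ^ 2 := by
    intro u
    have h1 : ∑ s ∈ A, S.lossVec u s = ∑ s ∈ A, S.mean u s + ∑ s ∈ A, S.noise u s := by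
      rw [← Finset.sum_add_distrib]
      simp [noise]
    have h2 : ‖∑ s ∈ A, S.mean u s‖ ≤ d * S.G := by
      calc _ ≤ ∑ s ∈ A, S.G := norm_sum_le_of_le _ fun s _ => S.norm_mean_le u s
        _ = A.card * S.G := by rw [Finset.sum_const, nsmul_eq_mul]
        _ ≤ _ := mul_le_mul_of_nonneg_right hA' hG.le
    -- Completing the square at scale `dG`: the noise has second moment at most `4dV²`, so dividing
    -- by `2dG` removes `d` and leaves `2V²/G`.
    have h3 : ∀ x : ℝ, x ≤ 1 / 2 * (d * S.G) + (2 * (d * S.G))⁻¹ * x ^ 2 := by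
      intro x
      have : 1 / 2 * (d * S.G) + (2 * (d * S.G))⁻¹ * x ^ 2 - x =
          (x - d * S.G) ^ 2 / (2 * (d * S.G)) := by
        field_simp
        ring
      rw [← sub_nonneg, this]
      positivity
    rw [h1]
    have := norm_add_le (∑ s ∈ A, S.mean u s) (∑ s ∈ A, S.noise u s)
    linarith [h3 ‖∑ s ∈ A, S.noise u s‖]
  calc _ ≤ ∫ u, (3 / 2 * (d * S.G) + (2 * (d * S.G))⁻¹ * ‖∑ s ∈ A, S.noise u s‖ ^ 2)
        ∂dirLaw k T :=
        integral_mono (integrable_of_continuous_of_compact (by fun_prop))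
          ((integrable_const _).add (hi1.const_mul _)) hpt
    _ = 3 / 2 * (d * S.G) + (2 * (d * S.G))⁻¹ * ∫ u, ‖∑ s ∈ A, S.noise u s‖ ^ 2 ∂dirLaw k T := by
        rw [integral_add (integrable_const _) (hi1.const_mul _)]
        congr 1
        · simp
        · exact integral_const_mul _ _
    _ ≤ 3 / 2 * (d * S.G) + (2 * (d * S.G))⁻¹ * (d * (2 * V) ^ 2) := by
        have := S.integral_norm_sum_noise_sq_le hV A
        gcongr
        exact this.trans (mul_le_mul_of_nonneg_right hA' (sq_nonneg _))
    _ = _ := by field_simp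

lemma sum_lossSeq_Ico (u : Fin T → UnitSphere k) {n m : ℕ} (hm : m ≤ T) :
    ∑ j ∈ Finset.Ico n m, S.lossSeq u j =
      ∑ s ∈ Finset.univ.filter (fun s => S.τ.rank s ∈ Finset.Ico n m), S.lossVec u s := by
  symm
  refine Finset.sum_bij (fun s _ => S.τ.rank s) (fun s hs => (Finset.mem_filter.1 hs).2) ?_ ?_ ?_
  · intro a _ b _ h
    rw [← S.τ.obsPerm_rank a, ← S.τ.obsPerm_rank b]
    simp only [h]
  · intro j hj
    have hjT : j < T := (Finset.mem_Ico.1 hj).2.trans_le hm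
    exact ⟨S.τ.obsPerm ⟨j, hjT⟩, by simpa [S.τ.rank_obsPerm] using hj, S.τ.rank_obsPerm _⟩
  · intro s _
    exact (S.lossSeq_rank u s).symm

lemma card_rank_mem_Ico_le (n m : ℕ) :
    (Finset.univ.filter (fun s => S.τ.rank s ∈ Finset.Ico n m)).card ≤ m - n := by
  rw [← Nat.card_Ico]
  refine Finset.card_le_card_of_injOn S.τ.rank (fun s hs => (Finset.mem_filter.1 hs).2) ?_
  intro a _ b _ h
  rw [← S.τ.obsPerm_rank a, ← S.τ.obsPerm_rank b]
  simp only [h]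

lemma integrable_norm_iter_sub [NeZero k] (m n : ℕ) :
    Integrable (fun u => ‖S.iter u m - S.iter u n‖) (dirLaw k T) :=
  integrable_of_continuous_of_compact ((S.continuous_iter m).sub (S.continuous_iter n)).norm

/-- Induction through the drift inequality. The summand `j = n` vanishes, leaving `m - n - 1` terms
bounded by `β = b/(λ(n+1))`; then `b + λ(m-n-1)β = mλβ`, so the bound reproduces itself without any
logarithm or exponential growth. -/
lemma integral_norm_iter_sub_le_of_sum_le [NeZero k] {b : ℝ} {n m : ℕ} (hnm : n ≤ m) (hb0 : 0 ≤ b)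
    (hb : ∀ j, n ≤ j → j ≤ m → ∫ u, ‖∑ i ∈ Finset.Ico n j, S.lossSeq u i‖ ∂dirLaw k T ≤ b) :
    ∫ u, ‖S.iter u m - S.iter u n‖ ∂dirLaw k T ≤ b / (S.lam * (n + 1)) := by
  have hlam := S.lam_pos
  induction m using Nat.strong_induction_on with
  | _ m ih =>
  rcases hnm.eq_or_lt with rfl | hlt
  · simp only [sub_self, norm_zero, integral_zero]
    positivity
  have hm0 : (0 : ℝ) < m := by exact_mod_cast (Nat.zero_le n).trans_lt hlt
  have hcs := fun j => S.continuous_lossSeq j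
  have hci := fun j => S.continuous_iter j
  have h1 : m * S.lam * ∫ u, ‖S.iter u m - S.iter u n‖ ∂dirLaw k T ≤
      b + S.lam * ∑ j ∈ Finset.Ico n m, ∫ u, ‖S.iter u j - S.iter u n‖ ∂dirLaw k T := by
    have hi1 : Integrable (fun u => ‖∑ i ∈ Finset.Ico n m, S.lossSeq u i‖) (dirLaw k T) :=
      integrable_of_continuous_of_compact (by fun_prop)
    have hi2 : Integrable (fun u => ∑ j ∈ Finset.Ico n m, ‖S.iter u j - S.iter u n‖)
        (dirLaw k T) := integrable_finsetSum _ fun j _ => S.integrable_norm_iter_sub j n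
    calc _ = ∫ u, m * S.lam * ‖S.iter u m - S.iter u n‖ ∂dirLaw k T := by
          rw [integral_const_mul]
      _ ≤ ∫ u, (‖∑ i ∈ Finset.Ico n m, S.lossSeq u i‖ +
            S.lam * ∑ j ∈ Finset.Ico n m, ‖S.iter u j - S.iter u n‖) ∂dirLaw k T :=
          integral_mono ((S.integrable_norm_iter_sub m n).const_mul _)
            (hi1.add (hi2.const_mul _))
            fun u => ftrlIter_drift S.isCompact S.convex hlam S.z₁_mem hnm
      _ ≤ _ := by
          rw [integral_add hi1 (hi2.const_mul _), integral_const_mul,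
            integral_finsetSum _ fun j _ => S.integrable_norm_iter_sub j n]
          exact add_le_add_left (hb m hnm le_rfl) _
  have h2 : ∑ j ∈ Finset.Ico n m, ∫ u, ‖S.iter u j - S.iter u n‖ ∂dirLaw k T ≤
      (m - n - 1) * (b / (S.lam * (n + 1))) := by
    rw [Finset.sum_eq_sum_Ico_succ_bot hlt]
    simp only [sub_self, norm_zero, integral_zero, zero_add]
    calc _ ≤ ∑ _j ∈ Finset.Ico (n + 1) m, b / (S.lam * (n + 1)) := by
          refine Finset.sum_le_sum fun j hj => ?_
          rw [Finset.mem_Ico] at hj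
          exact ih j hj.2 (by omega) fun i h1 h2 => hb i h1 (by omega)
      _ = _ := by
          rw [Finset.sum_const, Nat.card_Ico, nsmul_eq_mul, Nat.cast_sub (by omega)]
          push_cast
          ring
  have h3 := h1.trans (add_le_add_right (mul_le_mul_of_nonneg_left h2 hlam.le) b)
  have h4 : b + S.lam * ((m - n - 1) * (b / (S.lam * (n + 1)))) =
      m * S.lam * (b / (S.lam * (n + 1))) := by
    field_simp
    ring
  rw [h4] at h3
  exact le_of_mul_le_mul_left h3 (by positivity)

/-- The expected distance between the base predictions at the request and at the feedback of
round `s`. -/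
lemma integral_drift_le [NeZero k] (hG : 0 < S.G) {V : ℝ}
    (hV : ∀ s : Fin T, k * S.M / S.δ (s + 1) ≤ V)
    (s : Fin T) :
    S.G * ∫ u, ‖S.iter u (S.τ.rank s) - S.iter u (S.τ.seen s)‖ ∂dirLaw k T ≤
      4 * (S.G ^ 2 / S.lam * (S.τ.dualDelay s / (S.τ.rank s + 1)) +
        V ^ 2 / S.lam * (1 / (S.τ.rank s + 1))) := by
  have hlam := S.lam_pos
  have hsum := S.τ.seen_add_dualDelay s
  set d := S.τ.dualDelay s with hd
  set n := S.τ.seen s with hn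
  set m := S.τ.rank s with hm
  have hmT : m < T := S.τ.rank_lt s
  have hsum' : (n : ℝ) + d = m := by exact_mod_cast hsum
  rcases Nat.eq_zero_or_pos d with h0 | hdpos
  · have : n = m := by omega
    rw [this]
    simp only [sub_self, norm_zero, integral_zero, mul_zero]
    positivity
  -- If `n + 1` is at least half of `m + 1`, the recursion is sharp enough. Otherwise the delay
  -- exceeds half of `m + 1`, and the diameter bound suffices.
  rcases le_or_gt ((m : ℝ) + 1) (2 * (n + 1)) with hcase | hcase
  · have h1 := S.integral_norm_iter_sub_le_of_sum_le (n := n) (m := m)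
      (b := 3 / 2 * (d * S.G) + 2 * (V ^ 2 / S.G)) (by omega) (by positivity) (by
        intro j h1 h2
        simp only [S.sum_lossSeq_Ico _ (h2.trans hmT.le)]
        exact S.integral_norm_sum_lossVec_le hG hV hdpos
          ((S.card_rank_mem_Ico_le n j).trans (by omega)))
    calc _ ≤ S.G * ((3 / 2 * (d * S.G) + 2 * (V ^ 2 / S.G)) / (S.lam * (n + 1))) :=
          mul_le_mul_of_nonneg_left h1 hG.le
      _ = (3 / 2 * (d * S.G ^ 2) + 2 * V ^ 2) / S.lam * (1 / (n + 1)) := by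
          field_simp
      _ ≤ (3 / 2 * (d * S.G ^ 2) + 2 * V ^ 2) / S.lam * (2 / (m + 1)) := by
          refine mul_le_mul_of_nonneg_left ?_ (by positivity)
          rw [div_le_div_iff₀ (by positivity) (by positivity)]
          linarith
      _ = 3 * (S.G ^ 2 / S.lam * (d / (m + 1))) + 4 * (V ^ 2 / S.lam * (1 / (m + 1))) := by
          ring
      _ ≤ _ := by
          have : 0 ≤ S.G ^ 2 / S.lam * (d / ((m : ℝ) + 1)) := by positivity
          linarith
  · have h1 : ∫ u, ‖S.iter u m - S.iter u n‖ ∂dirLaw k T ≤ 2 * S.G / S.lam := by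
      have := integral_mono (S.integrable_norm_iter_sub m n)
        (integrable_const (μ := dirLaw k T) (2 * S.G / S.lam))
        fun u => S.norm_sub_le s (S.iter_mem u m) (S.iter_mem u n)
      simpa using this
    have h2 : (1 : ℝ) ≤ 2 * (d / (m + 1)) := by
      rw [← mul_div_assoc, le_div_iff₀ (by positivity)]
      linarith
    calc _ ≤ S.G * (2 * S.G / S.lam) := mul_le_mul_of_nonneg_left h1 hG.le
      _ = 2 * (S.G ^ 2 / S.lam) * 1 := by ring
      _ ≤ 2 * (S.G ^ 2 / S.lam) * (2 * (d / (m + 1))) :=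
          mul_le_mul_of_nonneg_left h2 (by positivity)
      _ = 4 * (S.G ^ 2 / S.lam * (d / (m + 1))) := by ring
      _ ≤ _ := by
          have : 0 ≤ V ^ 2 / S.lam * (1 / ((m : ℝ) + 1)) := by positivity
          linarith

end Setting

/-! ### Regret for general smoothing parameters. -/

namespace Setting

variable {k T : ℕ} (S : Setting k T)

/-- The regret of the wrapper as a function of the exploration directions. -/
noncomputable def regretAt (v : Vec k) (u : Fin T → UnitSphere k) : ℝ :=
  ∑ t, (S.f t (S.pred u t) - S.f t v)

lemma continuous_regretAt (v : Vec k) : Continuous (S.regretAt v) := by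
  unfold regretAt
  have := fun t => S.continuous_loss_pred t
  fun_prop

lemma regretAt_le {v : Vec k} (hv : v ∈ S.K) (u : Fin T → UnitSphere k) :
    S.regretAt v u ≤ T * (2 * (S.G ^ 2 / S.lam)) := by
  calc S.regretAt v u ≤ ∑ _t : Fin T, 2 * (S.G ^ 2 / S.lam) := by
        refine Finset.sum_le_sum fun t _ => ?_
        calc _ ≤ S.G * ‖S.pred u t - v‖ := (S.data t).sub_le S.lam_pos.le (S.pred_mem u t) hv
          _ ≤ S.G * (2 * S.G / S.lam) :=
            mul_le_mul_of_nonneg_left (S.norm_sub_le t (S.pred_mem u t) hv) (S.G_nonneg t)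
          _ = _ := by ring
    _ = _ := by simp

/-- The one-round bound holds at the iterate `Y` that was played. Moving it to the undelayed iterate
`Z` costs `G‖Z - Y‖` in the inner product and, through the diameter, `2G‖Z - Y‖` in the square. -/
lemma loss_sub_le [NeZero k] {v : Vec k} (hv : v ∈ S.K) (u : Fin T → UnitSphere k) (s : Fin T) :
    S.f s (S.pred u s) - S.f s v ≤
      inner ℝ (S.mean u s) (S.iter u (S.τ.rank s) - v)
        - S.lam / 2 * ‖S.iter u (S.τ.rank s) - v‖ ^ 2
        + 3 * (S.G * ‖S.iter u (S.τ.rank s) - S.iter u (S.τ.seen s)‖)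
        + 16 * (S.δ (s + 1) / S.r) * (S.G ^ 2 / S.lam) := by
  have hlam := S.lam_pos
  have h1 := (S.data s).sub_le_inner_onePoint hlam (S.δ_pos s) S.r_pos S.ball_subset
    (S.iter_mem u (S.τ.seen s)) hv (S.closedBall_subset s (S.iter_mem u _))
    (S.continuous_loss_smoothing u s) (S.pred_mem_closedBall u s)
  rw [← S.mean_eq u s] at h1
  have hY := S.norm_sub_le s (S.iter_mem u (S.τ.seen s)) hv
  have hZ := S.norm_sub_le s (S.iter_mem u (S.τ.rank s)) hv
  set Y := S.iter u (S.τ.seen s)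
  set Z := S.iter u (S.τ.rank s)
  have h2 : inner ℝ (S.mean u s) (Y - v) ≤
      inner ℝ (S.mean u s) (Z - v) + S.G * ‖Z - Y‖ := by
    have e : Y - v = (Z - v) + (Y - Z) := by abel
    rw [e, inner_add_right, norm_sub_rev Z Y]
    have := real_inner_le_norm (S.mean u s) (Y - Z)
    have := mul_le_mul_of_nonneg_right (S.norm_mean_le u s) (norm_nonneg (Y - Z))
    linarith
  have h3 : S.lam / 2 * (‖Z - v‖ ^ 2 - ‖Y - v‖ ^ 2) ≤ 2 * (S.G * ‖Z - Y‖) := by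
    have e : ‖Z - v‖ - ‖Y - v‖ ≤ ‖Z - Y‖ := by
      have := norm_sub_norm_le (Z - v) (Y - v)
      rwa [sub_sub_sub_cancel_right] at this
    have hsum : ‖Z - v‖ + ‖Y - v‖ ≤ 4 * S.G / S.lam := by
      have : 4 * S.G / S.lam = 2 * S.G / S.lam + 2 * S.G / S.lam := by ring
      linarith
    calc _ = S.lam / 2 * ((‖Z - v‖ - ‖Y - v‖) * (‖Z - v‖ + ‖Y - v‖)) := by ring
      _ ≤ S.lam / 2 * (‖Z - Y‖ * (4 * S.G / S.lam)) := by
        refine mul_le_mul_of_nonneg_left ?_ (by positivity)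
        calc _ ≤ ‖Z - Y‖ * (‖Z - v‖ + ‖Y - v‖) := mul_le_mul_of_nonneg_right e (by positivity)
          _ ≤ _ := mul_le_mul_of_nonneg_left hsum (norm_nonneg _)
      _ = _ := by field_simp; ring
  linarith

lemma sum_surrogate_le {V : ℝ} (hV : ∀ s : Fin T, k * S.M / S.δ (s + 1) ≤ V)
    {v : Vec k} (hv : v ∈ S.K) (u : Fin T → UnitSphere k) :
    ∑ s, (inner ℝ (S.lossVec u s) (S.iter u (S.τ.rank s) - v)
        - S.lam / 2 * ‖S.iter u (S.τ.rank s) - v‖ ^ 2) ≤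
      V ^ 2 / S.lam * ∑ j ∈ Finset.range T, 1 / ((j : ℝ) + 1) := by
  have hlam := S.lam_pos
  have h1 := ftrl_regret_le (c := S.lossSeq u) S.isCompact S.convex S.lam_pos S.z₁_mem T hv
  calc _ = ∑ s, (inner ℝ (S.lossSeq u (S.τ.rank s)) (S.iter u (S.τ.rank s) - v)
        - S.lam / 2 * ‖S.iter u (S.τ.rank s) - v‖ ^ 2) := by simp only [lossSeq_rank]
    _ = ∑ j ∈ Finset.range T, (inner ℝ (S.lossSeq u j) (S.iter u j - v)
        - S.lam / 2 * ‖S.iter u j - v‖ ^ 2) :=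
        S.τ.sum_comp_rank fun j => inner ℝ (S.lossSeq u j) (S.iter u j - v)
          - S.lam / 2 * ‖S.iter u j - v‖ ^ 2
    _ ≤ _ := h1
    _ ≤ ∑ j ∈ Finset.range T, V ^ 2 / S.lam * (1 / ((j : ℝ) + 1)) := by
        refine Finset.sum_le_sum fun j hj => ?_
        have h2 : ‖S.lossSeq u j‖ ^ 2 ≤ V ^ 2 := by
          rw [lossSeq, dif_pos (Finset.mem_range.1 hj)]
          exact pow_le_pow_left₀ (norm_nonneg _) ((S.norm_lossVec_le u _).trans (hV _)) 2
        calc _ = ‖S.lossSeq u j‖ ^ 2 / (2 * ((j + 1) * S.lam)) := by rw [mul_assoc]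
          _ ≤ V ^ 2 / ((j + 1) * S.lam) := by
            apply div_le_div₀ (sq_nonneg _) h2 (by positivity)
            have : 0 < ((j : ℝ) + 1) * S.lam := by positivity
            linarith
          _ = _ := by field_simp
    _ = _ := by rw [Finset.mul_sum]

/-- The regret bound for arbitrary admissible smoothing parameters. -/
lemma integral_regretAt_le [NeZero k] (hT : 2 ≤ T) (hG : 0 < S.G) {V : ℝ}
    (hV : ∀ s : Fin T, k * S.M / S.δ (s + 1) ≤ V) {v : Vec k} (hv : v ∈ S.K) :
    ∫ u, S.regretAt v u ∂dirLaw k T ≤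
      39 * (V ^ 2 / S.lam * Real.log T) +
      36 * (S.G ^ 2 / S.lam *
        min (S.τ.maxBacklog * Real.log T) (√(S.τ.totalDelay : ℝ))) +
      16 * (S.G ^ 2 / S.lam * ∑ s : Fin T, S.δ (s + 1) / S.r) := by
  have hlam := S.lam_pos
  have hcm := fun s => S.continuous_mean s
  have hcl := fun s => S.continuous_lossVec s
  have hci := fun m => S.continuous_iter m
  set H := ∑ j ∈ Finset.range T, 1 / ((j : ℝ) + 1) with hH
  have hHlog : H ≤ 3 * Real.log T := LatencyModel.sum_one_div_le_log hT
  have i1 : ∀ s, Integrable (fun u => inner ℝ (S.mean u s) (S.iter u (S.τ.rank s) - v))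
      (dirLaw k T) := fun s => integrable_of_continuous_of_compact (by fun_prop)
  have i1' : ∀ s, Integrable (fun u => inner ℝ (S.lossVec u s) (S.iter u (S.τ.rank s) - v))
      (dirLaw k T) := fun s => integrable_of_continuous_of_compact (by fun_prop)
  have i2 : ∀ s, Integrable (fun u => S.lam / 2 * ‖S.iter u (S.τ.rank s) - v‖ ^ 2)
      (dirLaw k T) := fun s => integrable_of_continuous_of_compact (by fun_prop)
  have i3 : ∀ s, Integrable (fun u => 3 * (S.G * ‖S.iter u (S.τ.rank s) - S.iter u (S.τ.seen s)‖))
      (dirLaw k T) := fun s => integrable_of_continuous_of_compact (by fun_prop)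
  have i12 : ∀ s, Integrable (fun u => inner ℝ (S.mean u s) (S.iter u (S.τ.rank s) - v)
      - S.lam / 2 * ‖S.iter u (S.τ.rank s) - v‖ ^ 2) (dirLaw k T) := fun s => (i1 s).sub (i2 s)
  have i12' : ∀ s, Integrable (fun u => inner ℝ (S.lossVec u s) (S.iter u (S.τ.rank s) - v)
      - S.lam / 2 * ‖S.iter u (S.τ.rank s) - v‖ ^ 2) (dirLaw k T) := fun s => (i1' s).sub (i2 s)
  have i123 : ∀ s, Integrable (fun u => inner ℝ (S.mean u s) (S.iter u (S.τ.rank s) - v)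
      - S.lam / 2 * ‖S.iter u (S.τ.rank s) - v‖ ^ 2
      + 3 * (S.G * ‖S.iter u (S.τ.rank s) - S.iter u (S.τ.seen s)‖)) (dirLaw k T) := fun s =>
    (i12 s).add (i3 s)
  have i4 : ∀ s, Integrable (fun u => S.f s (S.pred u s) - S.f s v) (dirLaw k T) := fun s =>
    integrable_of_continuous_of_compact ((S.continuous_loss_pred s).sub continuous_const)
  -- In expectation the mean is replaced by the loss vector, since the iterate at `rank s` ignores
  -- `u s`. The factor `12` is `3` from the move between iterates times `4` from the drift bound.
  have hround : ∀ s, ∫ u, (S.f s (S.pred u s) - S.f s v) ∂dirLaw k T ≤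
      ∫ u, (inner ℝ (S.lossVec u s) (S.iter u (S.τ.rank s) - v)
        - S.lam / 2 * ‖S.iter u (S.τ.rank s) - v‖ ^ 2) ∂dirLaw k T +
      12 * (S.G ^ 2 / S.lam * (S.τ.dualDelay s / (S.τ.rank s + 1)) +
        V ^ 2 / S.lam * (1 / (S.τ.rank s + 1))) +
      16 * (S.δ (s + 1) / S.r) * (S.G ^ 2 / S.lam) := by
    intro s
    have h1 := integral_mono (i4 s) ((i123 s).add
      (integrable_const (16 * (S.δ (s + 1) / S.r) * (S.G ^ 2 / S.lam)))) (S.loss_sub_le hv · s)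
    refine h1.trans ?_
    simp only [Pi.add_apply]
    rw [integral_add (i123 s) (integrable_const _), integral_add (i12 s) (i3 s),
      integral_sub (i1 s) (i2 s), integral_sub (i1' s) (i2 s),
      S.integral_inner_lossVec (Y := fun u => S.iter u (S.τ.rank s) - v) (by fun_prop)
        (fun u w => by rw [S.iter_update u le_rfl w])]
    have h2 := S.integral_drift_le hG hV s
    have h3 : ∫ u, 3 * (S.G * ‖S.iter u (S.τ.rank s) - S.iter u (S.τ.seen s)‖) ∂dirLaw k T =
        3 * (S.G * ∫ u, ‖S.iter u (S.τ.rank s) - S.iter u (S.τ.seen s)‖ ∂dirLaw k T) := by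
      rw [integral_const_mul, integral_const_mul]
    rw [h3, integral_const, probReal_univ, one_smul]
    linarith
  have hsur : ∑ s, ∫ u, (inner ℝ (S.lossVec u s) (S.iter u (S.τ.rank s) - v)
        - S.lam / 2 * ‖S.iter u (S.τ.rank s) - v‖ ^ 2) ∂dirLaw k T ≤ V ^ 2 / S.lam * H := by
    rw [← integral_finsetSum _ fun s _ => i12' s]
    have := integral_mono (integrable_finsetSum Finset.univ fun s _ => i12' s)
      (integrable_const (V ^ 2 / S.lam * H)) (S.sum_surrogate_le hV hv)
    rwa [integral_const, probReal_univ, one_smul] at this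
  have hdelay := S.τ.sum_dualDelay_div_le hT
  calc ∫ u, S.regretAt v u ∂dirLaw k T
      = ∑ s, ∫ u, (S.f s (S.pred u s) - S.f s v) ∂dirLaw k T :=
        integral_finsetSum _ fun s _ => i4 s
    _ ≤ ∑ s, (∫ u, (inner ℝ (S.lossVec u s) (S.iter u (S.τ.rank s) - v)
        - S.lam / 2 * ‖S.iter u (S.τ.rank s) - v‖ ^ 2) ∂dirLaw k T +
      12 * (S.G ^ 2 / S.lam * (S.τ.dualDelay s / (S.τ.rank s + 1)) +
        V ^ 2 / S.lam * (1 / (S.τ.rank s + 1))) +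
      16 * (S.δ (s + 1) / S.r) * (S.G ^ 2 / S.lam)) := Finset.sum_le_sum fun s _ => hround s
    _ = ∑ s, ∫ u, (inner ℝ (S.lossVec u s) (S.iter u (S.τ.rank s) - v)
        - S.lam / 2 * ‖S.iter u (S.τ.rank s) - v‖ ^ 2) ∂dirLaw k T +
      12 * (S.G ^ 2 / S.lam * ∑ s, (S.τ.dualDelay s : ℝ) / (S.τ.rank s + 1) +
        V ^ 2 / S.lam * H) +
      16 * (S.G ^ 2 / S.lam * ∑ s : Fin T, S.δ (s + 1) / S.r) := by
        rw [Finset.sum_add_distrib, Finset.sum_add_distrib, ← Finset.mul_sum,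
          Finset.sum_add_distrib, ← Finset.mul_sum, ← Finset.mul_sum, ← Finset.sum_mul,
          ← Finset.mul_sum, S.τ.sum_comp_rank fun j => 1 / ((j : ℝ) + 1)]
        ring
    _ ≤ _ := by
        -- The harmonic sum occurs `1 + 12` times, whence `39 = 13 * 3`; the delay sum gives `36 =
        -- 12 * 3`.
        have e1 := mul_le_mul_of_nonneg_left hdelay (show 0 ≤ S.G ^ 2 / S.lam by positivity)
        have e2 := mul_le_mul_of_nonneg_left hHlog (show 0 ≤ V ^ 2 / S.lam by positivity)
        linarith

end Setting

/-! ### Estimates for the smoothing schedules. -/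

section Smoothing

lemma rpow_third_pow {x : ℝ} (hx : 0 ≤ x) : (x ^ (1 / 3 : ℝ)) ^ 3 = x := by
  rw [← Real.rpow_natCast, ← Real.rpow_mul hx]
  norm_num

lemma rpow_two_thirds {x : ℝ} (hx : 0 ≤ x) : x ^ (2 / 3 : ℝ) = (x ^ (1 / 3 : ℝ)) ^ 2 := by
  rw [← Real.rpow_natCast, ← Real.rpow_mul hx]
  norm_num

lemma one_div_rpow_third_le (t : ℕ) :
    1 / ((t : ℝ) + 1) ^ (1 / 3 : ℝ) ≤
      3 / 2 * (((t : ℝ) + 1) ^ (2 / 3 : ℝ) - (t : ℝ) ^ (2 / 3 : ℝ)) := by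
  have ht : (0 : ℝ) ≤ t := Nat.cast_nonneg t
  rw [rpow_two_thirds ht, rpow_two_thirds (by positivity)]
  have h1 := rpow_third_pow ht
  have h2 := rpow_third_pow (show (0 : ℝ) ≤ t + 1 by positivity)
  set x := ((t : ℝ) + 1) ^ (1 / 3 : ℝ)
  set y := (t : ℝ) ^ (1 / 3 : ℝ)
  have hx : 0 < x := Real.rpow_pos_of_pos (by positivity) _
  have hy : 0 ≤ y := Real.rpow_nonneg ht _
  rw [div_le_iff₀ hx]
  -- As `x³ - y³ = 1`, the claim is `0 ≤ x³ - 3xy² + 2y³`, which factors in this way.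
  have : 0 ≤ (x - y) ^ 2 * (x + 2 * y) := by positivity
  nlinarith

lemma sum_one_div_rpow_third_le (T : ℕ) :
    ∑ t ∈ Finset.range T, 1 / ((t : ℝ) + 1) ^ (1 / 3 : ℝ) ≤ 3 / 2 * (T : ℝ) ^ (2 / 3 : ℝ) := by
  calc _ ≤ ∑ t ∈ Finset.range T,
        3 / 2 * (((t + 1 : ℕ) : ℝ) ^ (2 / 3 : ℝ) - (t : ℝ) ^ (2 / 3 : ℝ)) := by
        refine Finset.sum_le_sum fun t _ => ?_
        push_cast
        exact one_div_rpow_third_le t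
    _ = _ := by
        rw [← Finset.mul_sum, Finset.sum_range_sub (fun t : ℕ => (t : ℝ) ^ (2 / 3 : ℝ))]
        simp

/-- `log t / t` decreases from `e` on, so only `t = 2` needs the slack; `8` leaves room and has cube
root `2`. -/
lemma log_div_self_le_mul {t T : ℕ} (ht : 2 ≤ t) (htT : t ≤ T) :
    Real.log T / T ≤ 8 * (Real.log t / t) := by
  have hT0 : (0 : ℝ) < T := by exact_mod_cast (by omega : 0 < T)
  rcases Nat.lt_or_ge t 3 with h | h
  · obtain rfl : t = 2 := by omega
    have h1 : Real.log T / T ≤ 1 := by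
      rw [div_le_one hT0]
      have := Real.log_le_sub_one_of_pos hT0
      linarith
    have := Real.log_two_gt_d9
    push_cast
    linarith
  · have he : Real.exp 1 ≤ t := by
      have h3 : (3 : ℝ) ≤ t := by exact_mod_cast h
      linarith [Real.exp_one_lt_d9]
    have htT' : (t : ℝ) ≤ T := by exact_mod_cast htT
    have h1 : Real.log T / T ≤ Real.log t / t :=
      Real.log_div_self_antitoneOn (show Real.exp 1 ≤ (t : ℝ) from he)
        (show Real.exp 1 ≤ (T : ℝ) from he.trans htT') htT'
    have h2 : 0 ≤ Real.log t / t := by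
      have := Real.log_natCast_nonneg t
      positivity
    linarith

variable {k : ℕ} {r ν : ℝ}

lemma smoothing_le (hr : 0 < r) (t : ℕ) : smoothing k r ν t ≤ r :=
  mul_le_of_le_one_right hr.le (min_le_left _ _)

lemma smoothing_pos [NeZero k] (hr : 0 < r) (hν : 0 < ν) {t : ℕ} (ht : 2 ≤ t) :
    0 < smoothing k r ν t := by
  have hk : (0 : ℝ) < k := by exact_mod_cast Nat.pos_of_neZero k
  have ht' : (1 : ℝ) < t := by exact_mod_cast ht
  have := Real.log_pos ht'
  have : (0 : ℝ) < ν ^ 2 * (k : ℝ) ^ 2 * Real.log t / t := by positivity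
  exact mul_pos hr (lt_min one_pos (Real.rpow_pos_of_pos this _))

lemma smoothing_div_le (hr : 0 < r) (t : ℕ) :
    smoothing k r ν t / r ≤ (ν ^ 2 * (k : ℝ) ^ 2 * Real.log t / t) ^ (1 / 3 : ℝ) := by
  rw [smoothing, mul_div_cancel_left₀ _ hr.ne']
  exact min_le_right _ _

lemma smoothing_le_two_mul (hr : 0 < r) {t T : ℕ} (ht : 2 ≤ t) (htT : t ≤ T) :
    smoothing k r ν T ≤ 2 * smoothing k r ν t := by
  have hlt := Real.log_natCast_nonneg t
  have hlT := Real.log_natCast_nonneg T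
  have h8 : (8 : ℝ) ^ (1 / 3 : ℝ) = 2 := by
    rw [show (8 : ℝ) = 2 ^ (3 : ℝ) by norm_num, ← Real.rpow_mul (by norm_num)]
    norm_num
  have h1 : (ν ^ 2 * (k : ℝ) ^ 2 * Real.log T / T) ^ (1 / 3 : ℝ) ≤
      2 * (ν ^ 2 * (k : ℝ) ^ 2 * Real.log t / t) ^ (1 / 3 : ℝ) := by
    rw [← h8, ← Real.mul_rpow (by norm_num) (by positivity)]
    refine Real.rpow_le_rpow (by positivity) ?_ (by norm_num)
    have := mul_le_mul_of_nonneg_left (log_div_self_le_mul ht htT)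
      (show 0 ≤ ν ^ 2 * (k : ℝ) ^ 2 by positivity)
    calc _ = ν ^ 2 * (k : ℝ) ^ 2 * (Real.log T / T) := by ring
      _ ≤ _ := this
      _ = _ := by ring
  unfold smoothing
  rw [mul_left_comm]
  refine mul_le_mul_of_nonneg_left ?_ hr.le
  set x := (ν ^ 2 * (k : ℝ) ^ 2 * Real.log t / t) ^ (1 / 3 : ℝ)
  rcases le_total 1 x with h | h
  · rw [min_eq_left h]
    linarith [min_le_left 1 ((ν ^ 2 * (k : ℝ) ^ 2 * Real.log T / T) ^ (1 / 3 : ℝ))]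
  · rw [min_eq_right h]
    exact (min_le_right _ _).trans h1

variable {T : ℕ} {δ : ℕ → ℝ}

/-- Both kinds of schedules are bounded below by a multiple of `φ(T)`. -/
lemma smoothing_le_schedule (hr : 0 < r) (hT : 2 ≤ T)
    (h : IsRoundDependentSchedule k r ν δ ∨ IsFixedSchedule k T r ν δ) {t : ℕ} (ht : 1 ≤ t)
    (htT : t ≤ T) : smoothing k r ν T ≤ 2 * δ t := by
  rcases h with h | h
  · rcases Nat.lt_or_ge t 3 with h3 | h3
    · have h1 := (h.2 t ht (by omega)).1
      have h2 := smoothing_le_two_mul (k := k) (ν := ν) hr le_rfl hT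
      linarith
    · rw [h.1 t h3]
      exact smoothing_le_two_mul hr (by omega) htT
  · rw [h t ht]
    exact smoothing_le_two_mul hr hT le_rfl

lemma schedule_le (hr : 0 < r)
    (h : IsRoundDependentSchedule k r ν δ ∨ IsFixedSchedule k T r ν δ) {t : ℕ} (ht : 1 ≤ t) :
    δ t ≤ r := by
  rcases h with h | h
  · rcases Nat.lt_or_ge t 3 with h3 | h3
    · exact (h.2 t ht (by omega)).2.trans (smoothing_le hr 3)
    · rw [h.1 t h3]
      exact smoothing_le hr t
  · rw [h t ht]
    exact smoothing_le hr T

/-- Both kinds of schedules decay like `(ln T / t)^{1/3}`. -/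
lemma schedule_div_le (hr : 0 < r) (hT : 2 ≤ T)
    (h : IsRoundDependentSchedule k r ν δ ∨ IsFixedSchedule k T r ν δ) {t : ℕ} (ht : 1 ≤ t)
    (htT : t ≤ T) :
    δ t / r ≤ 2 * ((ν ^ 2 * (k : ℝ) ^ 2 * Real.log T) ^ (1 / 3 : ℝ) / (t : ℝ) ^ (1 / 3 : ℝ)) := by
  have ht0 : (0 : ℝ) < t := by exact_mod_cast ht
  have hT0 : (0 : ℝ) < T := by exact_mod_cast (by omega : 0 < T)
  have htT' : (t : ℝ) ≤ T := by exact_mod_cast htT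
  have hlT := Real.log_natCast_nonneg T
  have hl2 : Real.log 2 ≤ Real.log T := Real.log_le_log (by norm_num) (by exact_mod_cast hT)
  have hd9 := Real.log_two_gt_d9
  have h8 : (8 : ℝ) ^ (1 / 3 : ℝ) = 2 := by
    rw [show (8 : ℝ) = 2 ^ (3 : ℝ) by norm_num, ← Real.rpow_mul (by norm_num)]
    norm_num
  rw [← Real.div_rpow (by positivity) ht0.le, ← h8, ← Real.mul_rpow (by norm_num) (by positivity)]
  have key : ∀ m : ℕ, Real.log m / m ≤ 8 * (Real.log T / t) → δ t ≤ smoothing k r ν m →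
      δ t / r ≤ (8 * (ν ^ 2 * (k : ℝ) ^ 2 * Real.log T / t)) ^ (1 / 3 : ℝ) := by
    intro m hm hδ
    have hlm := Real.log_natCast_nonneg m
    refine (div_le_div_of_nonneg_right hδ hr.le).trans ((smoothing_div_le hr m).trans ?_)
    refine Real.rpow_le_rpow (by positivity) ?_ (by norm_num)
    have := mul_le_mul_of_nonneg_left hm (show 0 ≤ ν ^ 2 * (k : ℝ) ^ 2 by positivity)
    calc _ = ν ^ 2 * (k : ℝ) ^ 2 * (Real.log m / m) := by ring
      _ ≤ _ := this
      _ = _ := by ring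
  have hpos : 0 ≤ Real.log T / t := by positivity
  rcases h with h | h
  · rcases Nat.lt_or_ge t 3 with h3 | h3
    -- In rounds `1` and `2` only `δ t ≤ φ(3)` is known; `log 3 / 3 ≤ 1 ≤ 8 log T / t` because `t ≤
    -- 2 ≤ T`.
    · refine key 3 ?_ (h.2 t ht (by omega)).2
      have h1 : Real.log ((3 : ℕ) : ℝ) / ((3 : ℕ) : ℝ) ≤ 1 := by
        rw [div_le_one (by norm_num)]
        have := Real.log_le_sub_one_of_pos (show (0 : ℝ) < ((3 : ℕ) : ℝ) by norm_num)
        linarith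
      have h2 : (1 : ℝ) ≤ 8 * (Real.log T / t) := by
        rw [← mul_div_assoc, le_div_iff₀ ht0]
        have : (t : ℝ) ≤ 2 := by exact_mod_cast (by omega : t ≤ 2)
        linarith
      linarith
    · refine key t ?_ (h.1 t h3).le
      have : Real.log t / t ≤ Real.log T / t :=
        div_le_div_of_nonneg_right (Real.log_le_log ht0 htT') ht0.le
      linarith
  · refine key T ?_ (h t ht).le
    have : Real.log T / T ≤ Real.log T / t := div_le_div_of_nonneg_left hlT ht0 htT'
    linarith

lemma sum_schedule_div_le (hr : 0 < r) (hT : 2 ≤ T)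
    (h : IsRoundDependentSchedule k r ν δ ∨ IsFixedSchedule k T r ν δ) :
    ∑ s : Fin T, δ (s + 1) / r ≤
      3 * ((ν ^ 2 * (k : ℝ) ^ 2 * Real.log T) ^ (1 / 3 : ℝ) * (T : ℝ) ^ (2 / 3 : ℝ)) := by
  have hlT := Real.log_natCast_nonneg T
  set B := (ν ^ 2 * (k : ℝ) ^ 2 * Real.log T) ^ (1 / 3 : ℝ) with hB
  have hB0 : 0 ≤ B := Real.rpow_nonneg (by positivity) _
  calc ∑ s : Fin T, δ (s + 1) / r
      ≤ ∑ s : Fin T, 2 * B * (1 / (((s : ℕ) : ℝ) + 1) ^ (1 / 3 : ℝ)) := by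
        refine Finset.sum_le_sum fun s _ => ?_
        have := schedule_div_le hr hT h (t := s + 1) (by omega) (by omega)
        push_cast at this
        refine this.trans (le_of_eq ?_)
        ring
    _ = 2 * B * ∑ t ∈ Finset.range T, 1 / ((t : ℝ) + 1) ^ (1 / 3 : ℝ) := by
        rw [← Finset.mul_sum, Finset.sum_range]
    _ ≤ 2 * B * (3 / 2 * (T : ℝ) ^ (2 / 3 : ℝ)) :=
        mul_le_mul_of_nonneg_left (sum_one_div_rpow_third_le T) (by positivity)
    _ = _ := by ring

end Smoothing

/-! ### Tuning the smoothing parameters. -/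

lemma SubgradientData.lam_mul_sq_le {k : ℕ} [NeZero k] {K : Set (Vec k)} {G lam M r : ℝ}
    {f : Vec k → ℝ} {g : Vec k → Vec k} (h : SubgradientData K G lam f g) (hr : 0 < r)
    (hrK : Metric.closedBall 0 r ⊆ K) (hM : ∀ x ∈ K, |f x| ≤ M) : lam * r ^ 2 ≤ 4 * M := by
  obtain ⟨v, hv⟩ := exists_norm_eq (Vec k) hr.le
  have h0 : (0 : Vec k) ∈ K := hrK (by simp [hr.le])
  have h1 : v ∈ K := hrK (by simp [hv])
  have h2 : -v ∈ K := hrK (by simp [hv])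
  have e1 := h.strong 0 h0 v h1
  have e2 := h.strong 0 h0 (-v) h2
  rw [sub_zero] at e1 e2
  rw [inner_neg_right, norm_neg] at e2
  rw [hv] at e1 e2
  have b0 := abs_le.1 (hM 0 h0)
  have b1 := abs_le.1 (hM v h1)
  have b2 := abs_le.1 (hM (-v) h2)
  linarith

namespace Setting

variable {k T : ℕ} (S : Setting k T)

lemma integral_regretAt_le_of_schedule [NeZero k] (hT : 2 ≤ T) (hG : 0 < S.G) (hM : 0 < S.M)
    (hδ : IsRoundDependentSchedule k S.r (S.M / (S.G * S.r)) S.δ ∨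
      IsFixedSchedule k T S.r (S.M / (S.G * S.r)) S.δ) {v : Vec k} (hv : v ∈ S.K) :
    ∫ u, S.regretAt v u ∂dirLaw k T ≤ 204 * (S.G ^ 2 / S.lam *
      (min (S.τ.maxBacklog * Real.log T) (√(S.τ.totalDelay : ℝ)) +
        (T : ℝ) ^ (2 / 3 : ℝ) * Real.log T ^ (1 / 3 : ℝ) *
          (S.M / (S.G * S.r) * k) ^ (2 / 3 : ℝ))) := by
  have hlam := S.lam_pos
  have hr := S.r_pos
  have hk : (0 : ℝ) < k := by exact_mod_cast Nat.pos_of_neZero k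
  have hT0 : (0 : ℝ) < T := by exact_mod_cast (by omega : 0 < T)
  have hL : 0 < Real.log T := Real.log_pos (by exact_mod_cast hT)
  set ν := S.M / (S.G * S.r) with hν
  have hν0 : 0 < ν := by positivity
  set L := Real.log T with hLdef
  set D := min (S.τ.maxBacklog * L) (√(S.τ.totalDelay : ℝ)) with hD
  have hD0 : 0 ≤ D := le_min (by positivity) (Real.sqrt_nonneg _)
  set B := (ν ^ 2 * (k : ℝ) ^ 2 * L) ^ (1 / 3 : ℝ) with hB
  have hB0 : 0 < B := Real.rpow_pos_of_pos (by positivity) _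
  have hB3 : B ^ 3 = ν ^ 2 * (k : ℝ) ^ 2 * L := rpow_third_pow (by positivity)
  set x := (T : ℝ) ^ (1 / 3 : ℝ) with hx
  have hx0 : 0 < x := Real.rpow_pos_of_pos hT0 _
  have hx3 : x ^ 3 = T := rpow_third_pow hT0.le
  have hX : (T : ℝ) ^ (2 / 3 : ℝ) * L ^ (1 / 3 : ℝ) * (ν * k) ^ (2 / 3 : ℝ) = B * x ^ 2 := by
    rw [rpow_two_thirds hT0.le, hB, ← mul_pow, Real.mul_rpow (by positivity) hL.le,
      rpow_two_thirds (by positivity), ← Real.rpow_natCast (n := 2) (x := ν * k),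
      ← Real.rpow_natCast (n := 2) (x := (ν * k) ^ (1 / 3 : ℝ)), ← Real.rpow_mul (by positivity),
      ← Real.rpow_mul (by positivity), mul_comm ((2 : ℕ) : ℝ)]
    ring
  rw [hX]
  -- If `B ≥ T^{1/3}`, the trivial bound `2TG²/λ` is already of the target order; otherwise the
  -- minimum in `φ(T)` is attained by its second argument.
  rcases le_or_gt x B with hcase | hcase
  · calc ∫ u, S.regretAt v u ∂dirLaw k T
        ≤ T * (2 * (S.G ^ 2 / S.lam)) := by
          have := integral_mono
            (integrable_of_continuous_of_compact (μ := dirLaw k T) (S.continuous_regretAt v))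
            (integrable_const (T * (2 * (S.G ^ 2 / S.lam)))) (S.regretAt_le hv)
          rwa [integral_const, probReal_univ, one_smul] at this
      _ = 2 * (S.G ^ 2 / S.lam * (x * x ^ 2)) := by rw [← hx3]; ring
      _ ≤ 204 * (S.G ^ 2 / S.lam * (D + B * x ^ 2)) := by
          have h1 : x * x ^ 2 ≤ D + B * x ^ 2 := by nlinarith [sq_nonneg x]
          have h2 := mul_le_mul_of_nonneg_left h1 (show 0 ≤ S.G ^ 2 / S.lam by positivity)
          have h3 : 0 ≤ S.G ^ 2 / S.lam * (D + B * x ^ 2) := by positivity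
          linarith
  · have hsm : smoothing k S.r ν T = S.r * (B / x) := by
      rw [smoothing, ← hLdef, Real.div_rpow (by positivity) hT0.le, ← hB, ← hx, min_eq_right]
      exact (div_le_one hx0).2 hcase.le
    have hV : ∀ s : Fin T, k * S.M / S.δ (s + 1) ≤ 2 * (ν * k) * S.G * x / B := by
      intro s
      have h1 := smoothing_le_schedule hr hT hδ (t := s + 1) (by omega) (by omega)
      rw [hsm] at h1
      have h2 : S.r * (B / x) / 2 ≤ S.δ (s + 1) := by linarith
      calc _ ≤ k * S.M / (S.r * (B / x) / 2) :=
            div_le_div_of_nonneg_left (by positivity) (by positivity) h2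
        _ = _ := by rw [hν]; field_simp
    have h1 := S.integral_regretAt_le hT hG hV hv
    have h2 := mul_le_mul_of_nonneg_left (sum_schedule_div_le hr hT hδ)
      (show 0 ≤ S.G ^ 2 / S.lam by positivity)
    rw [← hLdef, ← hB, rpow_two_thirds hT0.le, ← hx] at h2
    -- The balance behind `φ`: since `B³ = ν²k² ln T`, the variance term has the same order `B x²`
    -- as the accumulated bias.
    have h3 : (2 * (ν * k) * S.G * x / B) ^ 2 / S.lam * L =
        4 * (S.G ^ 2 / S.lam * (B * x ^ 2)) := by
      calc _ = 4 * (S.G ^ 2 / S.lam) * x ^ 2 * (ν ^ 2 * (k : ℝ) ^ 2 * L) / B ^ 2 := by ring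
        _ = _ := by rw [← hB3]; field_simp
    rw [← hLdef, ← hD, h3] at h1
    have h4 : 0 ≤ S.G ^ 2 / S.lam * D := by positivity
    -- The constants add up as `39 * 4 + 16 * 3 = 204`, which also dominates the factor `36` of the
    -- delay term.
    rw [mul_add]
    linarith

end Setting

end DelayedBCO

/-! ### Transfer to an arbitrary probability space. -/

open DelayedBCO in
theorem mainTheorem2 :
    ∃ C : ℝ, 0 < C ∧
      ∀ (k T : ℕ), 1 ≤ k → 2 ≤ T →
      -- the domain, with `r 𝔹 ⊆ K ⊆ R 𝔹`
      ∀ (K : Set (Vec k)) (r R : ℝ), IsClosed K → Convex ℝ K → 0 < r → r < R →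
        Metric.closedBall 0 r ⊆ K → K ⊆ Metric.closedBall 0 R →
      -- the timing of predictions and observations, and the losses
      ∀ (τ : LatencyModel T) (f : Fin T → Vec k → ℝ) (G M lam : ℝ), 0 < lam →
        (∀ t, DifferentiableOn ℝ (f t) K) →
        (∀ t, ConvexOn ℝ K (f t)) →
        (∀ t, ∀ x ∈ K, ‖gradientWithin (f t) K x‖ ≤ G) →
        (∀ t, ∀ x ∈ K, |f t x| ≤ M) →
        (∀ t, IsStronglyConvex lam K (f t)) →
      -- the smoothing parameters, with smoothness ratio `ν = M / (G r)`
      ∀ (δ : ℕ → ℝ),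
        (IsRoundDependentSchedule k r (M / (G * r)) δ ∨ IsFixedSchedule k T r (M / (G * r)) δ) →
      -- the exploration directions: independent and uniform on the unit sphere
      ∀ (Ω : Type*) [MeasurableSpace Ω] (P : MeasureTheory.Measure Ω)
        [MeasureTheory.IsProbabilityMeasure P] (u : Fin T → Ω → UnitSphere k),
        (∀ t, Measurable (u t)) →
        (∀ t, P.map (u t) = unifSphere k) →
        ProbabilityTheory.iIndepFun u P →
      -- the initial point of P-FTRL and the best action in hindsight
      ∀ z₁ ∈ K, ∀ xstar ∈ K, IsMinOn (fun x => ∑ t, f t x) K xstar →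
        MeasureTheory.Integrable (fun ω =>
            regret (pFTRL K (fun n => 1 / (n * lam)) z₁) r δ τ f (fun t => u t ω) xstar) P ∧
          ∫ ω, regret (pFTRL K (fun n => 1 / (n * lam)) z₁) r δ τ f (fun t => u t ω) xstar ∂P ≤
            C * (G ^ 2 / lam *
              (min (τ.maxBacklog * Real.log T) (√(τ.totalDelay : ℝ)) +
                (T : ℝ) ^ (2 / 3 : ℝ) * Real.log T ^ (1 / 3 : ℝ) *
                  (M / (G * r) * k) ^ (2 / 3 : ℝ))) := by
  refine ⟨204, by norm_num, ?_⟩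
  intro k T hk hT K r R hKc hKconv hr _ hrK hKR τ f G M lam hlam _ _ hgrad hM hstrong δ hδ Ω _ P _ u
    hu hlaw hindep z₁ hz₁ xstar hxstar _
  have : NeZero k := ⟨by omega⟩
  have hdata : ∀ t, SubgradientData K G lam (f t) (gradientWithin (f t) K) := fun t =>
    ⟨hgrad t, hstrong t⟩
  let t₀ : Fin T := ⟨0, by omega⟩
  -- Strong convexity on a ball of positive radius forces `G > 0` and `M > 0`, so `ν` is well
  -- defined and positive.
  have hG : 0 < G := by
    have h1 : 0 < 2 * G / lam := hr.trans_le ((hdata t₀).radius_le hlam hr hrK)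
    have h2 := (div_pos_iff_of_pos_right hlam).1 h1
    linarith
  have hM0 : 0 < M := by
    have h1 := (hdata t₀).lam_mul_sq_le hr hrK (hM t₀)
    have h2 : 0 < lam * r ^ 2 := by positivity
    linarith
  let S : Setting k T :=
    { K := K, r := r, G := G, M := M, lam := lam, z₁ := z₁, δ := δ, τ := τ, f := f
      g := fun t => gradientWithin (f t) K
      isCompact := Metric.isCompact_of_isClosed_isBounded hKc
        (Metric.isBounded_closedBall.subset hKR)
      convex := hKconv
      r_pos := hr
      ball_subset := hrK
      lam_pos := hlam
      data := hdata
      abs_le := hM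
      z₁_mem := hz₁
      δ_pos := fun t => by
        have h1 := smoothing_le_schedule hr hT hδ (t := t + 1) (by omega) (by omega)
        have h2 := smoothing_pos (k := k) (ν := M / (G * r)) hr (by positivity) hT
        linarith
      δ_le := fun t => schedule_le hr hδ (by omega) }
  -- Independence identifies the joint law of the directions with the product law, under which the
  -- regret is a continuous function.
  have hmeas : Measurable fun ω t => u t ω := measurable_pi_iff.2 hu
  have hmap : P.map (fun ω t => u t ω) = Setting.dirLaw k T := by
    rw [(iIndepFun_iff_map_fun_eq_pi_map fun t => (hu t).aemeasurable).1 hindep]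
    simp only [hlaw]
  have hint : Integrable (S.regretAt xstar) (P.map fun ω t => u t ω) := by
    rw [hmap]
    exact integrable_of_continuous_of_compact (S.continuous_regretAt xstar)
  refine ⟨hint.comp_measurable hmeas, ?_⟩
  have hbound := S.integral_regretAt_le_of_schedule hT hG hM0 hδ hxstar
  rw [← hmap, integral_map hmeas.aemeasurable hint.aestronglyMeasurable] at hbound
  exact hbound
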